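/- \textbf{General form.} Let $N$ and $\Pi$ be non-decreasing right-continuous functions vanishing on $(-\infty,1)$ and on $(-\infty,1]$, respectively, such that for $\operatorname{Re} s>1$ both integrals in $$\zeta(s)=\int_{1^-}^\infty x^{-s}\,dN(x)=\exp\left(\int_1^\infty x^{-s}\,d\Pi(x)\right)$$ converge and the equality holds, and put $\log\zeta(s)=\int_1^\infty x^{-s}\,d\Pi(x)$. Suppose that $N(x)\sim ax$ as $x\to\infty$ for some real $a$, and that the function $\log\zeta(s)-\log(1/(s-1))$ (principal logarithm of $1/(s-1)$) on $\operatorname{Re} s>1$ extends continuously to $\operatorname{Re} s\ge 1$. Then $dN$ has an inverse $dM$ under multiplicative convolution among the real measures on $[1,\infty)$ of locally bounded variation, i.e. $dM*dN=\delta_1$, and for every such $dM$ $$m(x)=\int_{1^-}^x\frac{dM(t)}{t}=o(1)\qquad (x\to\infty).$$ \textbf{Discrete form.} Let $1<p_1\le p_2\le\cdots$ be an unbounded sequence of real numbers (generalized primes). Its generalized integers are the products $\prod_k p_k^{\alpha_k}$ over all finitely supported exponent vectors $\alpha$ of non-negative integers, counted with multiplicity (one for each $\alpha$) and listed as $1=n_0<n_1\le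 n_2\le\cdots$. Let $N(x)=\sum_{n_k\le x}1$, let $\mu(n_k)=(-1)^r$ if $n_k$ corresponds to a product of $r$ generalized primes with distinct indices and $\mu(n_k)=0$ otherwise, and let $\log\zeta(s)=\sum_k\sum_{j\ge1}p_k^{-js}/j$. If $N(x)\sim ax$ as $x\to\infty$ for some real $a$, and $\log\zeta(s)-\log(1/(s-1))$ on $\operatorname{Re} s>1$ extends continuously to $\operatorname{Re} s\ge1$, then $$m(x)=\sum_{n_k\le x}\frac{\mu(n_k)}{n_k}=o(1)\qquad (x\to\infty).$$ -/

import Mathlib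

open MeasureTheory Filter Asymptotics

namespace Beurling

noncomputable section

/-! ### Generalized number systems that need not be discrete

A non-decreasing, right-continuous function on `[1, ∞)` is represented by its Lebesgue-Stieltjes
measure, a locally finite measure on `ℝ` carried by `[1, ∞)`. -/

/-- The Mellin-Stieltjes transform `∫ x ^ (-s) dA(x)`. -/
def mellinStieltjes (A : Measure ℝ) (s : ℂ) : ℂ := ∫ x, (x : ℂ) ^ (-s) ∂A

/-- `dN` and `dPi` are the measures of the integer counting function `N` and of the Riemann prime
counting function `Π` of a generalized number system: `N` and `Π` are non-decreasing, `dN` is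
carried by `[1, ∞)`, `dPi` is carried by `(1, ∞)`, and for `Re s > 1` both integrals in
`ζ(s) = ∫_{1⁻}^∞ x ^ (-s) dN(x) = exp (∫_1^∞ x ^ (-s) dΠ(x))` converge and the equality holds. -/
structure IsNumberSystem (dN dPi : Measure ℝ) : Prop where
  locallyFinite_N : IsLocallyFiniteMeasure dN
  locallyFinite_Pi : IsLocallyFiniteMeasure dPi
  support_N : dN (Set.Iio 1) = 0
  support_Pi : dPi (Set.Iic 1) = 0
  integrable_N : ∀ s : ℂ, 1 < s.re → Integrable (fun x : ℝ => (x : ℂ) ^ (-s)) dN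
  integrable_Pi : ∀ s : ℂ, 1 < s.re → Integrable (fun x : ℝ => (x : ℂ) ^ (-s)) dPi
  zeta_eq : ∀ s : ℂ, 1 < s.re → mellinStieltjes dN s = Complex.exp (mellinStieltjes dPi s)

/-- The counting function `x ↦ dA((-∞, x])`. -/
def countingFun (dA : Measure ℝ) (x : ℝ) : ℝ := dA.real (Set.Iic x)

/-- The real measure `dM = dP - dQ` (of locally bounded variation, carried by `[1, ∞)`) is the
multiplicative convolution inverse of `dN`, that is, `dM ∗ dN = δ₁`. The equation is written with
the negative part moved to the other side because `dM` may have infinite total variation. -/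
structure IsConvInverse (dN dP dQ : Measure ℝ) : Prop where
  locallyFinite_P : IsLocallyFiniteMeasure dP
  locallyFinite_Q : IsLocallyFiniteMeasure dQ
  support_P : dP (Set.Iio 1) = 0
  support_Q : dQ (Set.Iio 1) = 0
  conv_eq : dP.mconv dN = dQ.mconv dN + Measure.dirac 1

/-- `m(x) = ∫_{1⁻}^x dM(t) / t` for `dM = dP - dQ`. -/
def moebiusMean (dP dQ : Measure ℝ) (x : ℝ) : ℝ :=
  (∫ t in Set.Iic x, t⁻¹ ∂dP) - ∫ t in Set.Iic x, t⁻¹ ∂dQ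

/-! ### Discrete generalized number systems -/

/-- `p 0 ≤ p 1 ≤ p 2 ≤ …` is an unbounded sequence of real numbers with `p 0 > 1`. -/
structure IsPrimeSystem (p : ℕ → ℝ) : Prop where
  mono : Monotone p
  one_lt : 1 < p 0
  unbounded : ¬ BddAbove (Set.range p)

/-- The generalized integer `∏ p_k ^ (α k)`. The generalized integers, counted with multiplicity,
are indexed by the exponent vectors `α`. -/
def genInt (p : ℕ → ℝ) (α : ℕ →₀ ℕ) : ℝ := α.prod fun k e => p k ^ e

/-- `N(x)`, the number of generalized integers up to `x`, counted with multiplicity. -/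
def intCount (p : ℕ → ℝ) (x : ℝ) : ℝ := (Set.ncard {α : ℕ →₀ ℕ | genInt p α ≤ x} : ℝ)

open Classical in
/-- The Möbius function: `(-1) ^ r` at a product of `r` generalized primes with distinct indices,
and `0` at all other generalized integers. -/
def moebius (α : ℕ →₀ ℕ) : ℝ := if ∀ k, α k ≤ 1 then (-1) ^ α.support.card else 0

/-- `m(x) = ∑_{n ≤ x} μ(n) / n`, over the generalized integers `n`. -/
def moebiusSum (p : ℕ → ℝ) (x : ℝ) : ℝ :=
  ∑ᶠ α ∈ {α : ℕ →₀ ℕ | genInt p α ≤ x}, moebius α / genInt p α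

/-- `log ζ(s) = ∫ x ^ (-s) dΠ(x)` for `Π(x) = π(x) + π(x ^ (1/2)) / 2 + π(x ^ (1/3)) / 3 + …`,
that is, `∑_k ∑_{j ≥ 1} p_k ^ (-j s) / j`. -/
def logZeta (p : ℕ → ℝ) (s : ℂ) : ℂ :=
  ∑' q : ℕ × ℕ, (p q.1 : ℂ) ^ (-(((q.2 : ℂ) + 1) * s)) / ((q.2 : ℂ) + 1)

/-- Only finitely many generalized integers are at most `x`, so that `intCount` and `moebiusSum`
are genuine finite counts and sums. -/
theorem finite_genInt_le {p : ℕ → ℝ} (hp : IsPrimeSystem p) (x : ℝ) :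
    {α : ℕ →₀ ℕ | genInt p α ≤ x}.Finite := by
  have h1 : ∀ k, 1 < p k := fun k => hp.one_lt.trans_le (hp.mono (Nat.zero_le k))
  obtain ⟨K, hK⟩ : ∃ K, x < p K := by
    by_contra h
    push Not at h
    exact hp.unbounded ⟨x, by rintro _ ⟨k, rfl⟩; exact h k⟩
  obtain ⟨E, hE⟩ := pow_unbounded_of_one_lt x hp.one_lt
  have key : ∀ α : ℕ →₀ ℕ, genInt p α ≤ x → ∀ k ∈ α.support, p k ^ α k ≤ x := by
    intro α hα k hk
    refine le_trans ?_ hα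
    unfold genInt Finsupp.prod
    rw [← Finset.mul_prod_erase _ _ hk]
    refine le_mul_of_one_le_right (by have := h1 k; positivity) ?_
    refine Finset.prod_induction _ (fun y => (1 : ℝ) ≤ y) (fun _ _ => one_le_mul_of_one_le_of_one_le) le_rfl ?_
    intro i _
    exact one_le_pow₀ (h1 i).le
  let f : ℕ →₀ ℕ := Finsupp.onFinset (Finset.range K) (fun k => if k < K then E else 0)
    (by intro a ha; by_contra h; simp_all)
  refine (Set.finite_Icc (0 : ℕ →₀ ℕ) f).subset ?_
  intro α hα
  refine ⟨zero_le, fun k => ?_⟩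
  by_cases hk : k ∈ α.support
  · have hx := key α hα k hk
    have hk0 : α k ≠ 0 := Finsupp.mem_support_iff.mp hk
    have hkK : k < K := by
      by_contra h
      have h2 : p K ≤ p k := hp.mono (not_lt.mp h)
      have h3 : p k ≤ p k ^ α k := le_self_pow₀ (h1 k).le hk0
      linarith
    have hlt : α k < E := by
      by_contra h
      have h2 : p 0 ^ E ≤ p 0 ^ α k := pow_le_pow_right₀ hp.one_lt.le (not_lt.mp h)
      have h3 : p 0 ^ α k ≤ p k ^ α k :=
        pow_le_pow_left₀ (by linarith [hp.one_lt]) (hp.mono (Nat.zero_le k)) _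
      linarith
    simp only [f, Finsupp.onFinset_apply, if_pos hkK]
    exact hlt.le
  · rw [Finsupp.notMem_support_iff.mp hk]
    exact Nat.zero_le _

/-! ### The boundary condition -/

/-- `L(s) - log (1 / (s - 1))`, given on `Re s > 1`, extends continuously to `Re s ≥ 1`. On
`Re s > 1` the principal logarithm of `1 / (s - 1)` is holomorphic, and real for real `s`. -/
def HasContinuousExtension (L : ℂ → ℂ) : Prop :=
  ∃ F : ℂ → ℂ, ContinuousOn F {s : ℂ | 1 ≤ s.re} ∧
    ∀ s : ℂ, 1 < s.re → F s = L s - Complex.log (1 / (s - 1))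

end

end Beurling

namespace Beurling

open FourierTransform Topology ContDiff

/-! Put f(u) = m(e^u). Its Laplace transform at s is 1/s times the transform of dM at 1 + s, that is
exp(-log ζ(1 + s)) / s. If log ζ(1 + s) = F(1 + s) + log(1/s) with F continuous up to the boundary,
then exp(-log(1/s)) = s cancels the 1/s and leaves exp(-F(1 + s)), which is continuous on Re s ≥ 0.
Since |dM| ≤ dN and N(x) ~ ax, f grows at most linearly and oscillates slowly. The Tauberian theorem
`tendsto_zero_of_laplace` then gives f → 0: smoothing f by a kernel whose Fourier transform has
compact support yields a function tending to zero by the Riemann-Lebesgue lemma, and slow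
oscillation removes the smoothing.

Both forms reduce to `moebiusMean_isLittleO`, which needs measures P, Q with P + Q ≤ dN whose
transforms differ by exp(-log ζ). In the general form they are the even and odd parts of the
convolution exponential of dΠ, with transforms cosh and sinh of log ζ; uniqueness of transforms
gives P + Q = dN and (P - Q) * dN = δ₁ (`IsNumberSystem.mconvExp_spec`), and any other inverse has
the same mean (`IsConvInverse.add_eq_add`). In the discrete form they carry the positive and
negative parts of μ, and the Euler product supplies the transform (`exp_neg_logZeta`). -/

/-! ### A Tauberian theorem for Laplace transforms. -/

theorem integrable_exp_neg_mul_of_linear_growth {f : ℝ → ℝ} (hf : Measurable f)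
    (hf0 : ∀ u < 0, f u = 0) {C : ℝ} (hC : ∀ u, |f u| ≤ C * (1 + |u|)) {σ : ℝ} (hσ : 0 < σ) :
    Integrable (fun u => Real.exp (-σ * u) * f u) := by
  have h1 : IntegrableOn (fun u : ℝ => C * (Real.exp (-σ * u) + u ^ (1 : ℝ) * Real.exp (-σ * u)))
      (Set.Ioi 0) := by
    refine ((integrableOn_exp_mul_Ioi (by linarith) 0).add ?_).const_mul C
    simpa using integrableOn_rpow_mul_exp_neg_mul_rpow (p := 1) (s := 1) (b := σ) (by norm_num)
      zero_lt_one hσ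
  have h2 : IntegrableOn (fun u => Real.exp (-σ * u) * f u) (Set.Ici 0) := by
    rw [integrableOn_Ici_iff_integrableOn_Ioi]
    refine h1.mono' (by fun_prop) ?_
    filter_upwards [ae_restrict_mem measurableSet_Ioi] with u hu
    have hu : 0 < u := hu
    have := hC u
    rw [abs_of_pos hu] at this
    rw [norm_mul, Real.norm_eq_abs, Real.norm_eq_abs, Real.abs_exp, Real.rpow_one]
    nlinarith [Real.exp_pos (-σ * u)]
  refine (integrableOn_iff_integrable_of_support_subset ?_).1 h2
  intro u hu
  by_contra h
  exact hu (by simp [hf0 u (not_le.1 h)])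

/-- Fubini: expanding `𝓕 φ (v - u)` puts the Laplace transform of f at σ - 2πix under the
x-integral. The factor e^(-σu) provides absolute convergence. -/
theorem integral_laplace_mul_fourier {f : ℝ → ℝ} {φ : ℝ → ℂ} {G : ℂ → ℂ} {σ : ℝ}
    (hf : Integrable (fun u => Real.exp (-σ * u) * f u)) (hφ : Integrable φ)
    (hG : ∀ s : ℂ, s.re = σ → ∫ u : ℝ, Complex.exp (-s * u) * f u = G s) (v : ℝ) :
    ∫ u : ℝ, (Real.exp (-σ * u) * f u : ℝ) * 𝓕 φ (v - u) =
      𝓕 (fun x : ℝ => φ x * G (σ - 2 * Real.pi * x * Complex.I)) v := by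
  have hI : Integrable (fun z : ℝ × ℝ => ((Real.exp (-σ * z.1) * f z.1 : ℝ) : ℂ) *
      (Complex.exp (((-2 * Real.pi * z.2 * (v - z.1) : ℝ) : ℂ) * Complex.I) • φ z.2)) := by
    have h := (hf.ofReal (𝕜 := ℂ)).mul_prod hφ
    refine (h.bdd_mul (c := 1)
      (f := fun z : ℝ × ℝ => Complex.exp (((-2 * Real.pi * z.2 * (v - z.1) : ℝ) : ℂ) * Complex.I))
      (Continuous.aestronglyMeasurable (by fun_prop)) ?_).congr ?_
    · exact ae_of_all _ fun z => (Complex.norm_exp_ofReal_mul_I _).le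
    · refine ae_of_all _ fun z => ?_
      simp only [smul_eq_mul, RCLike.ofReal_eq_complex_ofReal]
      ring
  simp_rw [Real.fourier_real_eq_integral_exp_smul, ← integral_const_mul]
  rw [integral_integral_swap hI]
  refine integral_congr_ae (ae_of_all _ fun x => ?_)
  simp only [smul_eq_mul]
  rw [← hG _ (by simp), ← integral_const_mul, ← integral_const_mul]
  refine integral_congr_ae (ae_of_all _ fun u => ?_)
  have : Complex.exp (((-2 * Real.pi * x * (v - u) : ℝ) : ℂ) * Complex.I) =
      Complex.exp (((-2 * Real.pi * x * v : ℝ) : ℂ) * Complex.I) *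
        Complex.exp (2 * Real.pi * x * u * Complex.I) := by
    rw [← Complex.exp_add]; congr 1; push_cast; ring
  have h2 : Complex.exp (-(σ - 2 * Real.pi * x * Complex.I) * u) =
      Complex.exp (-σ * u) * Complex.exp (2 * Real.pi * x * u * Complex.I) := by
    rw [← Complex.exp_add]; congr 1; ring
  simp only [this, h2]
  push_cast
  ring

theorem integrable_linear_mul_comp_sub (C : ℝ) {K : ℝ → ℂ} (hK : Integrable K)
    (hK1 : Integrable (fun z : ℝ => |z| * ‖K z‖)) (v : ℝ) :
    Integrable (fun u => (C * (1 + |u|)) * ‖K (v - u)‖) := by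
  have h : Integrable (fun z => (C * (1 + |v - z|)) * ‖K z‖) := by
    refine (((hK.norm.const_mul (1 + |v|)).add hK1).const_mul |C|).mono'
      (AEStronglyMeasurable.mul (by fun_prop) hK.norm.aestronglyMeasurable) (ae_of_all _ fun z => ?_)
    rw [norm_mul, norm_mul, norm_norm, Real.norm_eq_abs, Real.norm_eq_abs,
      abs_of_nonneg (by positivity : 0 ≤ 1 + |v - z|)]
    have h1 : |v - z| ≤ |v| + |z| := abs_sub _ _
    simp only [Pi.add_apply]
    rw [mul_assoc]
    refine mul_le_mul_of_nonneg_left ?_ (abs_nonneg C)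
    nlinarith [norm_nonneg (K z)]
  simpa using h.comp_sub_left v

/-- The Fubini identity holds for σ > 0 and passes to σ → 0. On the left, linear growth is dominated
thanks to the first moment of `𝓕 φ`; on the right, the compact support of φ confines G to a compact
set, where it is bounded. The limit is the Fourier transform of an integrable function, so
Riemann-Lebesgue applies. -/
theorem tendsto_integral_mul_fourier_of_laplace {f : ℝ → ℝ} (hf : Measurable f)
    (hf0 : ∀ u < 0, f u = 0) {C : ℝ} (hC : ∀ u, |f u| ≤ C * (1 + |u|)) {G : ℂ → ℂ}
    (hGc : ContinuousOn G {s | 0 ≤ s.re})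
    (hG : ∀ s : ℂ, 0 < s.re → ∫ u : ℝ, Complex.exp (-s * u) * f u = G s)
    {φ : ℝ → ℂ} (hφ : Continuous φ) (hφc : HasCompactSupport φ) (hK : Integrable (𝓕 φ))
    (hK1 : Integrable (fun z : ℝ => |z| * ‖𝓕 φ z‖)) :
    Tendsto (fun v => ∫ u : ℝ, (f u : ℂ) * 𝓕 φ (v - u)) atTop (𝓝 0) := by
  have hφi : Integrable φ := hφ.integrable_of_hasCompactSupport hφc
  have key : ∀ v, ∫ u : ℝ, (f u : ℂ) * 𝓕 φ (v - u) =
      𝓕 (fun x : ℝ => φ x * G (((0 : ℝ) : ℂ) - 2 * Real.pi * x * Complex.I)) v := by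
    intro v
    have hdom := integrable_linear_mul_comp_sub C hK hK1 v
    have hmeas : AEStronglyMeasurable (fun u => 𝓕 φ (v - u)) :=
      (hK.comp_sub_left v).aestronglyMeasurable
    have h1 : Tendsto (fun σ : ℝ => ∫ u : ℝ, ((Real.exp (-σ * u) * f u : ℝ) : ℂ) * 𝓕 φ (v - u))
        (𝓝[>] 0) (𝓝 (∫ u : ℝ, (f u : ℂ) * 𝓕 φ (v - u))) := by
      refine tendsto_integral_filter_of_dominated_convergence _ ?_ ?_ hdom ?_
      · refine Eventually.of_forall fun σ => AEStronglyMeasurable.mul ?_ hmeas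
        exact Measurable.aestronglyMeasurable (by fun_prop)
      · filter_upwards [self_mem_nhdsWithin] with σ hσ
        have hσ : 0 < σ := hσ
        refine ae_of_all _ fun u => ?_
        rw [norm_mul, Complex.norm_real, norm_mul]
        refine mul_le_mul_of_nonneg_right ?_ (norm_nonneg _)
        rcases lt_or_ge u 0 with hu | hu
        · rw [hf0 u hu]
          simpa using (abs_nonneg _).trans (hC u)
        · refine le_trans ?_ (hC u)
          rw [Real.norm_eq_abs, Real.norm_eq_abs, Real.abs_exp]
          refine mul_le_of_le_one_left (abs_nonneg _) (Real.exp_le_one_iff.2 ?_)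
          nlinarith
      · refine ae_of_all _ fun u => ?_
        have : Tendsto (fun σ : ℝ => ((Real.exp (-σ * u) * f u : ℝ) : ℂ) * 𝓕 φ (v - u))
          (𝓝 0) (𝓝 (((Real.exp (-0 * u) * f u : ℝ) : ℂ) * 𝓕 φ (v - u))) :=
          Continuous.tendsto (by fun_prop) 0
        simpa using this.mono_left nhdsWithin_le_nhds
    obtain ⟨R, hR⟩ := hφc.isCompact.isBounded.subset_closedBall (0 : ℝ)
    set S : Set ℂ := (fun z : ℝ × ℝ => (z.1 : ℂ) - 2 * Real.pi * z.2 * Complex.I) ''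
      (Set.Icc 0 1 ×ˢ Metric.closedBall 0 R)
    have hS : IsCompact S :=
      (isCompact_Icc.prod (isCompact_closedBall 0 R)).image (by fun_prop)
    have hSre : S ⊆ {s | 0 ≤ s.re} := by
      rintro _ ⟨z, hz, rfl⟩
      simpa using hz.1.1
    obtain ⟨B, hB⟩ := hS.exists_bound_of_continuousOn (hGc.mono hSre)
    have hGσ : ∀ σ : ℝ, 0 ≤ σ →
        Continuous (fun x : ℝ => G ((σ : ℂ) - 2 * Real.pi * x * Complex.I)) := by
      intro σ hσ
      exact hGc.comp_continuous (by fun_prop) (fun x => by simpa using hσ)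
    have h2 : Tendsto (fun σ : ℝ => 𝓕 (fun x : ℝ => φ x * G ((σ : ℂ) - 2 * Real.pi * x * Complex.I)) v)
        (𝓝[>] 0) (𝓝 (𝓕 (fun x : ℝ => φ x * G (((0 : ℝ) : ℂ) - 2 * Real.pi * x * Complex.I)) v)) := by
      simp_rw [Real.fourier_real_eq_integral_exp_smul]
      refine tendsto_integral_filter_of_dominated_convergence (fun x => ‖φ x‖ * B) ?_ ?_
        (hφi.norm.mul_const B) ?_
      · filter_upwards [self_mem_nhdsWithin] with σ hσ
        have := hGσ σ (le_of_lt hσ)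
        exact Continuous.aestronglyMeasurable
          (Continuous.smul (f := fun x : ℝ => Complex.exp (((-2 * Real.pi * x * v : ℝ) : ℂ) *
            Complex.I)) (by fun_prop) (hφ.mul this))
      · filter_upwards [Ioc_mem_nhdsGT (zero_lt_one' ℝ)] with σ hσ
        refine ae_of_all _ fun x => ?_
        rw [norm_smul, Complex.norm_exp_ofReal_mul_I, one_mul, norm_mul]
        by_cases hx : x ∈ tsupport φ
        · exact mul_le_mul_of_nonneg_left (hB _ ⟨(σ, x), ⟨⟨hσ.1.le, hσ.2⟩, hR hx⟩, rfl⟩)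
            (norm_nonneg _)
        · simp [image_eq_zero_of_notMem_tsupport hx]
      · refine ae_of_all _ fun x => ?_
        refine Tendsto.const_smul (Tendsto.const_mul _ ?_) _
        refine (hGc _ (by simp)).tendsto.comp (tendsto_nhdsWithin_iff.2 ⟨?_, ?_⟩)
        · refine Tendsto.mono_left ?_ nhdsWithin_le_nhds
          exact Continuous.tendsto (by fun_prop) 0
        · filter_upwards [self_mem_nhdsWithin] with σ hσ
          simpa using le_of_lt hσ
    refine tendsto_nhds_unique (h1.congr' ?_) h2
    filter_upwards [self_mem_nhdsWithin] with σ hσ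
    have hσ : 0 < σ := hσ
    exact integral_laplace_mul_fourier (integrable_exp_neg_mul_of_linear_growth hf hf0 hC hσ) hφi
      (fun s hs => hG s (hs ▸ hσ)) v
  simp_rw [key]
  exact (Real.zero_at_infty_fourier _).mono_left atTop_le_cocompact

/-- There are approximate identities whose Fourier transforms have compact support. -/
theorem exists_fourier_approximateIdentity : ∃ B : ℝ, 0 < B ∧ ∀ l : ℝ, 0 < l → ∃ φ : ℝ → ℂ,
    Continuous φ ∧ HasCompactSupport φ ∧ Integrable (𝓕 φ) ∧
    Integrable (fun z : ℝ => |z| * ‖𝓕 φ z‖) ∧ ∫ z, 𝓕 φ z = 1 ∧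
    ∫ z, ‖𝓕 φ z‖ ≤ B ∧ ∫ z, |z| * ‖𝓕 φ z‖ ≤ B / l := by
  obtain ⟨φ, hφ0, hφc⟩ : ∃ φ : SchwartzMap ℝ ℂ, φ 0 = 1 ∧ HasCompactSupport φ := by
    let b : ContDiffBump (0 : ℝ) := ⟨1, 2, by norm_num, by norm_num⟩
    have h1 : HasCompactSupport (fun x => (b x : ℂ)) :=
      b.hasCompactSupport.comp_left (g := fun x : ℝ => (x : ℂ)) rfl
    have h2 : ContDiff ℝ ∞ (fun x => (b x : ℂ)) := Complex.ofRealCLM.contDiff.comp b.contDiff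
    refine ⟨h1.toSchwartzMap h2, ?_, h1⟩
    have : b 0 = 1 := b.one_of_mem_closedBall (by simp [b])
    change ((b 0 : ℝ) : ℂ) = 1
    rw [this, Complex.ofReal_one]
  set K : SchwartzMap ℝ ℂ := 𝓕 φ with hKdef
  have hK : ∀ w, K w = 𝓕 (φ : ℝ → ℂ) w := fun w => by rw [hKdef, SchwartzMap.fourier_coe]
  have hKi : Integrable (fun z => K z) := K.integrable
  have hK1 : Integrable (fun z : ℝ => |z| * ‖K z‖) := by
    simpa using K.integrable_pow_mul volume 1
  have hone : ∫ z, K z = 1 := by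
    have h := congrArg (fun g : SchwartzMap ℝ ℂ => g 0)
      (FourierTransform.fourierInv_fourier_eq (F := SchwartzMap ℝ ℂ) φ)
    simp only [hφ0] at h
    rw [← h, SchwartzMap.fourierInv_coe, Real.fourierInv_eq']
    simp [hKdef]
  have hB0 : 0 ≤ ∫ z, ‖K z‖ := integral_nonneg fun _ => norm_nonneg _
  have hB1 : 0 ≤ ∫ z, |z| * ‖K z‖ := integral_nonneg fun _ => by positivity
  refine ⟨(∫ z, ‖K z‖) + (∫ z, |z| * ‖K z‖) + 1, by positivity, fun l hl => ?_⟩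
  -- Dilation by l preserves the integral and the L¹ norm of the kernel and divides its first moment
  -- by l. The integral is φ(0) = 1 by Fourier inversion.
  have hscale : ∀ w, 𝓕 (fun x : ℝ => φ (l⁻¹ * x)) w = l * K (l * w) := by
    intro w
    rw [hK, Real.fourier_real_eq_integral_exp_smul, Real.fourier_real_eq_integral_exp_smul]
    have := Measure.integral_comp_mul_left (fun x : ℝ =>
      Complex.exp (((-2 * Real.pi * x * (l * w) : ℝ) : ℂ) * Complex.I) • φ x) l⁻¹
    simp only [inv_inv, abs_of_pos hl] at this
    rw [← Complex.real_smul, ← this]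
    congr 1 with x
    congr 4
    field_simp
  have hfun : 𝓕 (fun x : ℝ => φ (l⁻¹ * x)) = fun w => (l : ℂ) * K (l * w) := funext hscale
  have hnorm : ∀ w, ‖(l : ℂ) * K (l * w)‖ = l * ‖K (l * w)‖ := fun w => by
    rw [norm_mul, Complex.norm_real, Real.norm_of_nonneg hl.le]
  have habs : ∀ w, |w| * ‖(l : ℂ) * K (l * w)‖ = |l * w| * ‖K (l * w)‖ := fun w => by
    rw [hnorm, abs_mul, abs_of_pos hl]; ring
  refine ⟨fun x => φ (l⁻¹ * x), by fun_prop, ?_, ?_, ?_, ?_, ?_, ?_⟩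
  · exact hφc.comp_homeomorph (Homeomorph.mulLeft₀ l⁻¹ (by positivity))
  · rw [hfun]; exact (hKi.comp_mul_left' hl.ne').const_mul _
  · simp_rw [hfun, habs]; exact hK1.comp_mul_left' hl.ne'
  · simp_rw [hfun, integral_const_mul]
    rw [Measure.integral_comp_mul_left (fun x => K x) l, hone, abs_of_pos (by positivity)]
    simp [hl.ne']
  · simp_rw [hfun, hnorm, integral_const_mul]
    rw [Measure.integral_comp_mul_left (fun x => ‖K x‖) l, abs_of_pos (by positivity), smul_eq_mul,
      mul_inv_cancel_left₀ hl.ne']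
    linarith
  · simp_rw [hfun, habs]
    rw [Measure.integral_comp_mul_left (fun x => |x| * ‖K x‖) l, abs_of_pos (by positivity),
      smul_eq_mul, inv_mul_eq_div]
    gcongr
    linarith

/-- A slowly oscillating function whose Laplace transform extends continuously to the closed right
half-plane tends to zero. -/
theorem tendsto_zero_of_laplace {f : ℝ → ℝ} (hf : Measurable f)
    (hf0 : ∀ u < 0, f u = 0) {C : ℝ} (hC : ∀ u, |f u| ≤ C * (1 + |u|))
    (hosc : ∀ ε > 0, ∃ C' V : ℝ, ∀ v ≥ V, ∀ z, |f v - f (v - z)| ≤ ε + C' * |z|)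
    {G : ℂ → ℂ} (hGc : ContinuousOn G {s | 0 ≤ s.re})
    (hG : ∀ s : ℂ, 0 < s.re → ∫ u : ℝ, Complex.exp (-s * u) * f u = G s) :
    Tendsto f atTop (𝓝 0) := by
  obtain ⟨B, hB, hφ⟩ := exists_fourier_approximateIdentity
  rw [Metric.tendsto_nhds]
  intro ε hε
  -- With this tolerance and the dilation l chosen next, the smoothing error is at most (ε/4B)·B +
  -- (|C'| + 1)·B/l = ε/2; the summand 1 keeps l positive when C' = 0.
  obtain ⟨C', V, hV⟩ := hosc (ε / (4 * B)) (by positivity)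
  obtain ⟨φ, hφ, hφc, hK, hK1, hone, hKB, hK1B⟩ := hφ (4 * B * (|C'| + 1) / ε) (by positivity)
  have hlim := tendsto_integral_mul_fourier_of_laplace hf hf0 hC hGc hG hφ hφc hK hK1
  rw [Metric.tendsto_nhds] at hlim
  filter_upwards [hlim (ε / 4) (by positivity), eventually_ge_atTop V] with v hv hvV
  rw [dist_zero_right] at hv ⊢
  have hint : Integrable (fun u => (f u : ℂ) * 𝓕 φ (v - u)) := by
    refine (integrable_linear_mul_comp_sub C hK hK1 v).mono' ?_ (ae_of_all _ fun u => ?_)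
    · exact AEStronglyMeasurable.mul (Measurable.aestronglyMeasurable (by fun_prop))
        (hK.comp_sub_left v).aestronglyMeasurable
    · rw [norm_mul, Complex.norm_real]
      exact mul_le_mul_of_nonneg_right (hC u) (norm_nonneg _)
  have hint' : Integrable (fun z => (f (v - z) : ℂ) * 𝓕 φ z) := by
    simpa using hint.comp_sub_left v
  have hsub : ∫ u, (f u : ℂ) * 𝓕 φ (v - u) = ∫ z, (f (v - z) : ℂ) * 𝓕 φ z := by
    rw [← integral_sub_left_eq_self (fun u => (f u : ℂ) * 𝓕 φ (v - u)) volume v]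
    simp
  have hdiff : (f v : ℂ) - ∫ u, (f u : ℂ) * 𝓕 φ (v - u) =
      ∫ z, ((f v : ℂ) - f (v - z)) * 𝓕 φ z := by
    simp_rw [sub_mul]
    rw [integral_sub (hK.const_mul _) hint', integral_const_mul, hone, mul_one, hsub]
  have hbound : ‖(f v : ℂ) - ∫ u, (f u : ℂ) * 𝓕 φ (v - u)‖ ≤ ε / 4 + ε / 4 := by
    rw [hdiff]
    calc ‖∫ z, ((f v : ℂ) - f (v - z)) * 𝓕 φ z‖
        ≤ ∫ z, (ε / (4 * B) * ‖𝓕 φ z‖ + C' * (|z| * ‖𝓕 φ z‖)) := by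
          refine norm_integral_le_of_norm_le ((hK.norm.const_mul _).add (hK1.const_mul _))
            (ae_of_all _ fun z => ?_)
          rw [norm_mul, ← Complex.ofReal_sub, Complex.norm_real, ← mul_assoc, ← add_mul]
          exact mul_le_mul_of_nonneg_right (hV v hvV z) (norm_nonneg _)
      _ = ε / (4 * B) * (∫ z, ‖𝓕 φ z‖) + C' * ∫ z, |z| * ‖𝓕 φ z‖ := by
          rw [integral_add (hK.norm.const_mul _) (hK1.const_mul _), integral_const_mul,
            integral_const_mul]
      _ ≤ ε / (4 * B) * B + (|C'| + 1) * (B / (4 * B * (|C'| + 1) / ε)) := by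
          have h0 : 0 ≤ ∫ z : ℝ, |z| * ‖𝓕 φ z‖ := integral_nonneg fun _ => by positivity
          have h1 : C' ≤ |C'| + 1 := (le_abs_self _).trans (by linarith)
          gcongr
      _ = ε / 4 + ε / 4 := by
          have : |C'| + 1 ≠ 0 := by positivity
          field_simp
  have h := norm_le_norm_add_norm_sub (∫ u, (f u : ℂ) * 𝓕 φ (v - u)) (f v : ℂ)
  rw [norm_sub_rev, Complex.norm_real] at h
  rw [← Complex.norm_real, Complex.norm_real]
  linarith

/-! ### Logarithmic means: growth, oscillation and Laplace transform. -/

theorem measure_Iic_lt_top {A : Measure ℝ} [IsLocallyFiniteMeasure A] (hA : A (Set.Iio 1) = 0)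
    (x : ℝ) : A (Set.Iic x) < ⊤ := by
  have h : Set.Iic x ⊆ Set.Iio 1 ∪ Set.Icc 1 x := fun t ht => by
    rcases lt_or_ge t 1 with h | h
    · exact Or.inl h
    · exact Or.inr ⟨h, ht⟩
  refine (measure_mono h).trans_lt ((measure_union_le _ _).trans_lt ?_)
  rw [hA, zero_add]
  exact isCompact_Icc.measure_lt_top

theorem ae_one_le {A : Measure ℝ} (hA : A (Set.Iio 1) = 0) : ∀ᵐ t ∂A, 1 ≤ t := by
  rw [ae_iff]
  simpa [Set.Iio] using hA

theorem integrableOn_inv_Iic {A : Measure ℝ} (hA : A (Set.Iio 1) = 0)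
    (hfin : ∀ x, A (Set.Iic x) < ⊤) (x : ℝ) : IntegrableOn (fun t : ℝ => t⁻¹) (Set.Iic x) A := by
  refine IntegrableOn.of_bound (hfin x) (by fun_prop) 1 ?_
  filter_upwards [ae_restrict_of_ae (ae_one_le hA)] with t ht
  rw [Real.norm_of_nonneg (by positivity)]
  exact inv_le_one_of_one_le₀ ht

/-- `∫_{1⁻}^{exp u} dA(t) / t`. -/
noncomputable def logMean (A : Measure ℝ) (u : ℝ) : ℝ := ∫ t in Set.Iic (Real.exp u), t⁻¹ ∂A

theorem logMean_eq_zero {A : Measure ℝ} (hA : A (Set.Iio 1) = 0) {u : ℝ} (hu : u < 0) :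
    logMean A u = 0 := by
  refine setIntegral_measure_zero _ (measure_mono_null (fun t ht => ?_) hA)
  exact (Set.mem_Iic.1 ht).trans_lt (by simpa using hu)

theorem setIntegral_inv_Ioc {A : Measure ℝ} (hA : A (Set.Iio 1) = 0)
    (hfin : ∀ x, A (Set.Iic x) < ⊤) {x y : ℝ} (hxy : x ≤ y) :
    (∫ t in Set.Iic y, t⁻¹ ∂A) - ∫ t in Set.Iic x, t⁻¹ ∂A = ∫ t in Set.Ioc x y, t⁻¹ ∂A := by
  rw [sub_eq_iff_eq_add, ← Set.Iic_union_Ioc_eq_Iic hxy, setIntegral_union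
    (Set.disjoint_left.2 fun t h1 h2 => not_lt.2 (Set.mem_Iic.1 h1) h2.1) measurableSet_Ioc
    (integrableOn_inv_Iic hA hfin x)
    ((integrableOn_inv_Iic hA hfin y).mono_set Set.Ioc_subset_Iic_self), add_comm]

theorem setIntegral_inv_Ioc_nonneg {A : Measure ℝ} (hA : A (Set.Iio 1) = 0) (x y : ℝ) :
    0 ≤ ∫ t in Set.Ioc x y, t⁻¹ ∂A := by
  refine integral_nonneg_of_ae (ae_restrict_of_ae ?_)
  filter_upwards [ae_one_le hA] with t ht
  simp only [Pi.zero_apply]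
  positivity

theorem monotone_logMean {A : Measure ℝ} (hA : A (Set.Iio 1) = 0)
    (hfin : ∀ x, A (Set.Iic x) < ⊤) : Monotone (logMean A) := by
  intro u v huv
  have h := setIntegral_inv_Ioc hA hfin (Real.exp_le_exp.2 huv)
  have := setIntegral_inv_Ioc_nonneg hA (Real.exp u) (Real.exp v)
  unfold logMean
  linarith

/-- Here P + Q dominates the total variation of P - Q, so the oscillation of the signed mean is
controlled by dN. -/
theorem abs_logMean_sub_sub_le {P Q N : Measure ℝ} (hN : N (Set.Iio 1) = 0)
    (hfin : ∀ x, N (Set.Iic x) < ⊤) (hPQ : P + Q ≤ N) {u v : ℝ} (huv : u ≤ v) :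
    |(logMean P v - logMean Q v) - (logMean P u - logMean Q u)| ≤ logMean N v - logMean N u := by
  have hP : P ≤ N := (Measure.le_add_right le_rfl).trans hPQ
  have hQ : Q ≤ N := (Measure.le_add_left le_rfl).trans hPQ
  have hP0 : P (Set.Iio 1) = 0 := le_antisymm ((hP _).trans hN.le) zero_le
  have hQ0 : Q (Set.Iio 1) = 0 := le_antisymm ((hQ _).trans hN.le) zero_le
  have hPf : ∀ x, P (Set.Iic x) < ⊤ := fun x => (hP _).trans_lt (hfin x)
  have hQf : ∀ x, Q (Set.Iic x) < ⊤ := fun x => (hQ _).trans_lt (hfin x)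
  have hxy := Real.exp_le_exp.2 huv
  have e1 := setIntegral_inv_Ioc hP0 hPf hxy
  have e2 := setIntegral_inv_Ioc hQ0 hQf hxy
  have e3 := setIntegral_inv_Ioc hN hfin hxy
  have n1 := setIntegral_inv_Ioc_nonneg hP0 (Real.exp u) (Real.exp v)
  have n2 := setIntegral_inv_Ioc_nonneg hQ0 (Real.exp u) (Real.exp v)
  have hle : (∫ t in Set.Ioc (Real.exp u) (Real.exp v), t⁻¹ ∂P) +
      (∫ t in Set.Ioc (Real.exp u) (Real.exp v), t⁻¹ ∂Q) ≤
      ∫ t in Set.Ioc (Real.exp u) (Real.exp v), t⁻¹ ∂N := by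
    rw [← integral_add_measure, ← Measure.restrict_add]
    · refine integral_mono_measure (Measure.restrict_mono le_rfl hPQ) (ae_restrict_of_ae ?_)
        ((integrableOn_inv_Iic hN hfin _).mono_set Set.Ioc_subset_Iic_self)
      filter_upwards [ae_one_le hN] with t ht
      simp only [Pi.zero_apply]
      positivity
    · exact (integrableOn_inv_Iic hP0 hPf _).mono_set Set.Ioc_subset_Iic_self
    · exact (integrableOn_inv_Iic hQ0 hQf _).mono_set Set.Ioc_subset_Iic_self
  unfold logMean
  rw [abs_le]
  constructor <;> linarith

theorem logMean_sub_le {N : Measure ℝ} (hN : N (Set.Iio 1) = 0)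
    (hfin : ∀ x, N (Set.Iic x) < ⊤) {u v : ℝ} (huv : u ≤ v) :
    logMean N v - logMean N u ≤
      (countingFun N (Real.exp v) - countingFun N (Real.exp u)) / Real.exp u := by
  have hxy := Real.exp_le_exp.2 huv
  unfold logMean countingFun
  rw [setIntegral_inv_Ioc hN hfin hxy]
  have hIoc : N (Set.Ioc (Real.exp u) (Real.exp v)) ≠ ⊤ :=
    ((measure_mono Set.Ioc_subset_Iic_self).trans_lt (hfin _)).ne
  have h1 : N.real (Set.Iic (Real.exp v)) = N.real (Set.Iic (Real.exp u)) +
      N.real (Set.Ioc (Real.exp u) (Real.exp v)) := by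
    rw [← Set.Iic_union_Ioc_eq_Iic hxy, measureReal_union
      (Set.disjoint_left.2 fun t h1 h2 => not_lt.2 (Set.mem_Iic.1 h1) h2.1) measurableSet_Ioc (hfin _).ne hIoc]
  rw [h1, add_sub_cancel_left]
  calc ∫ t in Set.Ioc (Real.exp u) (Real.exp v), t⁻¹ ∂N
      ≤ ∫ t in Set.Ioc (Real.exp u) (Real.exp v), (Real.exp u)⁻¹ ∂N := by
        refine setIntegral_mono_on ((integrableOn_inv_Iic hN hfin _).mono_set
          Set.Ioc_subset_Iic_self) (integrableOn_const hIoc) measurableSet_Ioc fun t ht => ?_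
        exact inv_anti₀ (Real.exp_pos u) ht.1.le
    _ = _ := by simp [div_eq_mul_inv]

/-- Asymptotics give the bound beyond some X. Below X, monotonicity gives N(x) ≤ N(X) ≤ N(X)·x for x
≥ 1, and N vanishes below 1. -/
theorem exists_countingFun_le {N : Measure ℝ} (hN : N (Set.Iio 1) = 0)
    (hfin : ∀ x, N (Set.Iic x) < ⊤) {a : ℝ} (ha : countingFun N ~[atTop] fun x => a * x) :
    ∃ C : ℝ, 0 ≤ C ∧ ∀ x, 0 ≤ x → countingFun N x ≤ C * x := by
  obtain ⟨c, hc, h⟩ := (ha.isBigO.trans (isBigO_const_mul_self a (fun x => x) atTop)).exists_pos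
  obtain ⟨X, hX⟩ := eventually_atTop.1 h.bound
  refine ⟨c + countingFun N X, by unfold countingFun; positivity, fun x hx => ?_⟩
  have hX0 : 0 ≤ countingFun N X := by unfold countingFun; positivity
  rcases lt_or_ge x 1 with h1 | h1
  · have : countingFun N x = 0 := by
      unfold countingFun
      rw [measureReal_def, measure_mono_null (Set.Iic_subset_Iio.2 h1) hN,
        ENNReal.toReal_zero]
    rw [this]; positivity
  · rcases le_total X x with h2 | h2
    · have := hX x h2
      rw [Real.norm_of_nonneg hx] at this
      have h3 := (Real.le_norm_self _).trans this
      nlinarith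
    · have : countingFun N x ≤ countingFun N X :=
        measureReal_mono (Set.Iic_subset_Iic.2 h2) (hfin X).ne
      nlinarith

/-- An interval of length at most 1 contributes at most N(e^v)/e^u ≤ C·e; chain ⌈v - u⌉ of them. -/
theorem logMean_sub_le_of_linear_growth {N : Measure ℝ} (hN : N (Set.Iio 1) = 0)
    (hfin : ∀ x, N (Set.Iic x) < ⊤) {C : ℝ} (hC0 : 0 ≤ C)
    (hC : ∀ x, 0 ≤ x → countingFun N x ≤ C * x) {u v : ℝ} (huv : u ≤ v) :
    logMean N v - logMean N u ≤ C * Real.exp 1 * (1 + (v - u)) := by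
  have hmono := monotone_logMean hN hfin
  have step : ∀ u v, u ≤ v → v ≤ u + 1 → logMean N v - logMean N u ≤ C * Real.exp 1 := by
    intro u v h1 h2
    refine (logMean_sub_le hN hfin h1).trans ?_
    rw [div_le_iff₀ (Real.exp_pos u)]
    have h3 := hC _ (Real.exp_pos v).le
    have h4 : 0 ≤ countingFun N (Real.exp u) := by unfold countingFun; positivity
    have h5 : Real.exp v ≤ Real.exp 1 * Real.exp u := by
      rw [← Real.exp_add]; exact Real.exp_le_exp.2 (by linarith)
    nlinarith
  have chain : ∀ n : ℕ, ∀ u v : ℝ, u ≤ v → v ≤ u + n →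
      logMean N v - logMean N u ≤ n * (C * Real.exp 1) := by
    intro n
    induction n with
    | zero =>
      intro u v h1 h2
      have : u = v := le_antisymm h1 (by simpa using h2)
      simp [this]
    | succ n ih =>
      intro u v h1 h2
      push_cast at h2 ⊢
      have a1 := step u (min v (u + 1)) (le_min h1 (by linarith)) (min_le_right _ _)
      have a2 := ih (min v (u + 1)) v (min_le_left _ _) (by
        rcases min_cases v (u + 1) with h | h
        · rw [h.1]; have : (0 : ℝ) ≤ n := n.cast_nonneg
          linarith
        · rw [h.1]; linarith)
      linarith
  have h1 := chain ⌈v - u⌉₊ u v huv (by linarith [Nat.le_ceil (v - u)])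
  have h2 := (Nat.ceil_lt_add_one (sub_nonneg.2 huv)).le
  have h3 : 0 ≤ C * Real.exp 1 := by positivity
  nlinarith

/-- Let t = v - u. For t ≤ 1 the asymptotics bound the increment by a(e^t - 1) + (ε/4)(e^t + 1), and
e^t - 1 ≤ 2t makes this at most 2|a|t + ε. For t ≥ 1 the unit-step bound C·e·(1 + t) ≤ 2C·e·t
suffices. -/
theorem exists_logMean_sub_le {N : Measure ℝ} (hN : N (Set.Iio 1) = 0)
    (hfin : ∀ x, N (Set.Iic x) < ⊤) {a : ℝ} (ha : countingFun N ~[atTop] fun x => a * x)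
    {ε : ℝ} (hε : 0 < ε) : ∃ C V : ℝ, ∀ u v, u ≤ v → V ≤ v →
      logMean N v - logMean N u ≤ ε + C * (v - u) := by
  obtain ⟨C, hC0, hC⟩ := exists_countingFun_le hN hfin ha
  have hev : ∀ᶠ x : ℝ in atTop, |countingFun N x - a * x| ≤ ε / 4 * x := by
    have h := (ha.isLittleO.trans_isBigO (isBigO_const_mul_self a (fun x => x) atTop)).def
      (show 0 < ε / 4 by positivity)
    filter_upwards [h, eventually_ge_atTop 0] with x hx hx0
    simpa [Real.norm_of_nonneg hx0] using hx
  obtain ⟨X, hX⟩ := eventually_atTop.1 hev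
  have hD : 0 ≤ C * Real.exp 1 := by positivity
  -- The extra 1 in V ensures that u ≥ v - 1 also lies in the asymptotic range.
  refine ⟨2 * |a| + 2 * (C * Real.exp 1), Real.log (max X 1) + 1, fun u v huv hv => ?_⟩
  rcases le_total (v - u) 1 with h1 | h1
  · have hXu : X ≤ Real.exp u := by
      refine (le_max_left X 1).trans ?_
      rw [← Real.log_le_iff_le_exp (by positivity)]
      linarith
    have hXv : X ≤ Real.exp v := hXu.trans (Real.exp_le_exp.2 huv)
    have b1 := (abs_le.1 (hX _ hXu)).1
    have b2 := (abs_le.1 (hX _ hXv)).2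
    refine (logMean_sub_le hN hfin huv).trans ?_
    rw [div_le_iff₀ (Real.exp_pos u)]
    have hexp : Real.exp v = Real.exp u * Real.exp (v - u) := by
      rw [← Real.exp_add]; ring_nf
    set t := v - u
    have ht : 0 ≤ t := sub_nonneg.2 huv
    have c1 : Real.exp t - 1 ≤ 2 * t := by
      have := Real.abs_exp_sub_one_le (x := t) (by rwa [abs_of_nonneg ht])
      rw [abs_of_nonneg ht] at this
      exact (le_abs_self _).trans this
    have c0 : 0 ≤ Real.exp t - 1 := by linarith [Real.add_one_le_exp t]
    have c2 : a * (Real.exp t - 1) ≤ |a| * (2 * t) :=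
      (mul_le_mul_of_nonneg_right (le_abs_self a) c0).trans
        (mul_le_mul_of_nonneg_left c1 (abs_nonneg a))
    have hu := Real.exp_pos u
    have c3 : countingFun N (Real.exp v) - countingFun N (Real.exp u) ≤
        (a * (Real.exp t - 1) + ε / 4 * (Real.exp t + 1)) * Real.exp u := by
      rw [hexp] at b2 ⊢
      nlinarith
    refine c3.trans (mul_le_mul_of_nonneg_right ?_ hu.le)
    nlinarith [mul_nonneg hD ht]
  · have h := logMean_sub_le_of_linear_growth hN hfin hC0 hC huv
    nlinarith [mul_nonneg (abs_nonneg a) (sub_nonneg.2 huv)]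

theorem logMean_le_of_linear_growth {N : Measure ℝ} (hN : N (Set.Iio 1) = 0)
    (hfin : ∀ x, N (Set.Iic x) < ⊤) {C : ℝ} (hC0 : 0 ≤ C)
    (hC : ∀ x, 0 ≤ x → countingFun N x ≤ C * x) (u : ℝ) :
    |logMean N u| ≤ 2 * (C * Real.exp 1) * (1 + |u|) := by
  have hD : 0 ≤ C * Real.exp 1 := by positivity
  rcases lt_or_ge u 0 with hu | hu
  · rw [logMean_eq_zero hN hu, abs_zero]; positivity
  -- Starting from -1, where the mean vanishes, includes a possible atom of N at 1.
  · have h0 := logMean_eq_zero hN (show (-1 : ℝ) < 0 by norm_num)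
    have h1 := logMean_sub_le_of_linear_growth hN hfin hC0 hC (show -1 ≤ u by linarith)
    have h2 := monotone_logMean hN hfin (show -1 ≤ u by linarith)
    rw [h0] at h1 h2
    rw [abs_of_nonneg h2, abs_of_nonneg hu]
    nlinarith

/-- The Laplace transform of `logMean A`, by Fubini's theorem. -/
theorem integrable_cpow_and_laplace_logMean {A : Measure ℝ} [SFinite A] (hA : A (Set.Iio 1) = 0)
    (hfin : ∀ x, A (Set.Iic x) < ⊤) {D : ℝ} (hD : ∀ u, |logMean A u| ≤ D * (1 + |u|))
    {s : ℂ} (hs : 0 < s.re) :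
    Integrable (fun x : ℝ => (x : ℂ) ^ (-(1 + s))) A ∧
    ∫ u : ℝ, Complex.exp (-s * u) * logMean A u = mellinStieltjes A (1 + s) / s := by
  -- Integrating this kernel over t gives e^(-su) times the mean; integrating over u ≥ log t gives
  -- t^(-1-s)/s.
  set k : ℝ × ℝ → ℂ := fun z => Complex.exp (-s * z.1) *
    (({z : ℝ × ℝ | z.2 ≤ Real.exp z.1}.indicator (fun z => z.2⁻¹) z : ℝ) : ℂ) with hk
  have hset : MeasurableSet {z : ℝ × ℝ | z.2 ≤ Real.exp z.1} :=
    measurableSet_le (by fun_prop) (by fun_prop)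
  have hkm : Measurable k := by
    refine Measurable.mul (by fun_prop) (Complex.measurable_ofReal.comp ?_)
    exact Measurable.indicator (by fun_prop) hset
  have hslice : ∀ u t : ℝ, {z : ℝ × ℝ | z.2 ≤ Real.exp z.1}.indicator (fun z => z.2⁻¹) (u, t) =
      (Set.Iic (Real.exp u)).indicator (fun t => t⁻¹) t := fun u t => rfl
  have hinner : ∀ u, Integrable ((Set.Iic (Real.exp u)).indicator (fun t => t⁻¹)) A := fun u =>
    (integrableOn_inv_Iic hA hfin _).integrable_indicator measurableSet_Iic
  have hki : Integrable k (volume.prod A) := by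
    rw [integrable_prod_iff hkm.aestronglyMeasurable]
    refine ⟨ae_of_all _ fun u => ((hinner u).ofReal (𝕜 := ℂ)).const_mul (Complex.exp (-s * u)), ?_⟩
    have h := integrable_exp_neg_mul_of_linear_growth (monotone_logMean hA hfin).measurable
      (fun u hu => logMean_eq_zero hA hu) hD hs
    refine h.congr (ae_of_all _ fun u => ?_)
    simp only [hk, hslice, norm_mul, Complex.norm_real, integral_const_mul]
    congr 1
    · rw [Complex.norm_exp]; simp
    · unfold logMean
      rw [← integral_indicator measurableSet_Iic]
      refine integral_congr_ae ?_
      filter_upwards [ae_one_le hA] with t ht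
      rw [Real.norm_of_nonneg]
      rw [Set.indicator_apply]
      split_ifs <;> positivity
  have houter : ∀ t : ℝ, 1 ≤ t → ∫ u, k (u, t) = (t : ℂ) ^ (-(1 + s)) / s := by
    intro t ht
    have ht0 : 0 < t := by linarith
    have hs0 : s ≠ 0 := fun h => by simp [h] at hs
    have : ∀ u, k (u, t) = (Set.Ici (Real.log t)).indicator
        (fun u : ℝ => Complex.exp (-s * u) * (t : ℂ)⁻¹) u := by
      intro u
      have : t ≤ Real.exp u ↔ Real.log t ≤ u := (Real.log_le_iff_le_exp ht0).symm
      by_cases h : t ≤ Real.exp u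
      · simp [hk, Set.indicator, h, this.1 h]
      · simp [hk, Set.indicator, h, mt this.2 h]
    simp_rw [this]
    rw [integral_indicator measurableSet_Ici, integral_Ici_eq_integral_Ioi, integral_mul_const,
      integral_exp_mul_complex_Ioi (by simpa using hs), Complex.cpow_def_of_ne_zero (by
        exact_mod_cast ht0.ne'), ← Complex.ofReal_log ht0.le]
    have h2 : Complex.exp (Real.log t * -(1 + s)) = Complex.exp (-s * Real.log t) * (t : ℂ)⁻¹ := by
      rw [show (Real.log t : ℂ) * -(1 + s) = -s * Real.log t + -Real.log t by ring,
        Complex.exp_add, Complex.exp_neg (Real.log t : ℂ), ← Complex.ofReal_exp, Real.exp_log ht0]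
    rw [h2]
    field_simp
  have hs0 : s ≠ 0 := fun h => by simp [h] at hs
  refine ⟨?_, ?_⟩
  -- Convergence of the transform comes for free, as a marginal of the integrable kernel.
  · refine (hki.integral_prod_right.mul_const s).congr ?_
    filter_upwards [ae_one_le hA] with t ht
    rw [houter t ht, div_mul_cancel₀ _ hs0]
  · have e1 : ∀ u : ℝ, Complex.exp (-s * u) * logMean A u = ∫ t, k (u, t) ∂A := by
      intro u
      simp only [hk, hslice, integral_const_mul]
      rw [integral_complex_ofReal, integral_indicator measurableSet_Iic, logMean]
    simp_rw [e1]
    rw [integral_integral_swap hki]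
    unfold mellinStieltjes
    rw [← integral_div]
    refine integral_congr_ae ?_
    filter_upwards [ae_one_le hA] with t ht
    exact houter t ht

/-! ### The criterion shared by both forms. -/

theorem moebiusMean_isLittleO {N P Q : Measure ℝ} [IsLocallyFiniteMeasure N]
    [IsLocallyFiniteMeasure P] [IsLocallyFiniteMeasure Q]
    (hN : N (Set.Iio 1) = 0) (hPQ : P + Q ≤ N) {a : ℝ}
    (ha : countingFun N ~[atTop] fun x => a * x) {L : ℂ → ℂ} (hL : HasContinuousExtension L)
    (hinv : ∀ s : ℂ, 1 < s.re →
      mellinStieltjes P s - mellinStieltjes Q s = Complex.exp (-L s)) :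
    moebiusMean P Q =o[atTop] (fun _ : ℝ => (1 : ℝ)) := by
  have hfin := measure_Iic_lt_top hN
  have hP : P ≤ N := (Measure.le_add_right le_rfl).trans hPQ
  have hQ : Q ≤ N := (Measure.le_add_left le_rfl).trans hPQ
  have hP0 : P (Set.Iio 1) = 0 := le_antisymm ((hP _).trans hN.le) zero_le
  have hQ0 : Q (Set.Iio 1) = 0 := le_antisymm ((hQ _).trans hN.le) zero_le
  have hPf : ∀ x, P (Set.Iic x) < ⊤ := fun x => (hP _).trans_lt (hfin x)
  have hQf : ∀ x, Q (Set.Iic x) < ⊤ := fun x => (hQ _).trans_lt (hfin x)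
  obtain ⟨C, hC0, hC⟩ := exists_countingFun_le hN hfin ha
  have hCA : ∀ A : Measure ℝ, A ≤ N → ∀ x, 0 ≤ x → countingFun A x ≤ C * x := fun A hA x hx =>
    (ENNReal.toReal_mono (hfin x).ne (hA _)).trans (hC x hx)
  have hDP := logMean_le_of_linear_growth hP0 hPf hC0 (hCA P hP)
  have hDQ := logMean_le_of_linear_growth hQ0 hQf hC0 (hCA Q hQ)
  have hmP := (monotone_logMean hP0 hPf).measurable
  have hmQ := (monotone_logMean hQ0 hQf).measurable
  obtain ⟨F, hFc, hF⟩ := hL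
  have key : Tendsto (fun u => logMean P u - logMean Q u) atTop (𝓝 0) := by
    refine tendsto_zero_of_laplace (C := 4 * (C * Real.exp 1))
      (G := fun s => Complex.exp (-F (1 + s))) (hmP.sub hmQ) ?_ ?_ ?_ ?_ ?_
    · intro u hu
      rw [logMean_eq_zero hP0 hu, logMean_eq_zero hQ0 hu, sub_zero]
    · intro u
      have := abs_sub (logMean P u) (logMean Q u)
      linarith [hDP u, hDQ u]
    · intro ε hε
      obtain ⟨C', V, h⟩ := exists_logMean_sub_le hN hfin ha hε
      refine ⟨|C'|, V, fun v hv z => ?_⟩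
      rcases le_total 0 z with hz | hz
      · refine (abs_logMean_sub_sub_le hN hfin hPQ (show v - z ≤ v by linarith)).trans
          ((h _ _ (by linarith) hv).trans ?_)
        rw [abs_of_nonneg hz, sub_sub_cancel]
        have := mul_le_mul_of_nonneg_right (le_abs_self C') hz
        linarith
      · rw [abs_sub_comm]
        refine (abs_logMean_sub_sub_le hN hfin hPQ (show v ≤ v - z by linarith)).trans
          ((h _ _ (by linarith) (by linarith)).trans ?_)
        rw [abs_of_nonpos hz]
        have := mul_le_mul_of_nonneg_right (le_abs_self C') (neg_nonneg.2 hz)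
        linarith
    · refine Complex.continuous_exp.comp_continuousOn (ContinuousOn.neg ?_)
      exact hFc.comp (by fun_prop) fun s hs => by simpa using hs
    · intro s hs
      have hs0 : s ≠ 0 := fun h => by simp [h] at hs
      have hI : ∀ {A : Measure ℝ}, Measurable (logMean A) → A (Set.Iio 1) = 0 →
          (∀ u, |logMean A u| ≤ 2 * (C * Real.exp 1) * (1 + |u|)) →
          Integrable (fun u : ℝ => Complex.exp (-s * u) * logMean A u) := by
        intro A hm h0 hD
        have h := integrable_exp_neg_mul_of_linear_growth hm
          (fun u hu => logMean_eq_zero h0 hu) hD hs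
        refine h.norm.mono' (Measurable.aestronglyMeasurable (by fun_prop)) (ae_of_all _ fun u => ?_)
        simp [Complex.norm_exp]
      have h1s : 1 < (1 + s).re := by simpa using hs
      simp_rw [Complex.ofReal_sub, mul_sub]
      -- The factor exp(log(1/s)) in the denominator equals 1/s and cancels the 1/s of the Laplace
      -- transform.
      rw [integral_sub (hI hmP hP0 hDP) (hI hmQ hQ0 hDQ),
        (integrable_cpow_and_laplace_logMean hP0 hPf hDP hs).2,
        (integrable_cpow_and_laplace_logMean hQ0 hQf hDQ hs).2, ← sub_div, hinv _ h1s, hF _ h1s,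
        neg_sub, add_sub_cancel_left, Complex.exp_sub,
        Complex.exp_log (one_div_ne_zero hs0), Complex.exp_neg]
      field_simp
  rw [isLittleO_one_iff]
  refine (key.comp Real.tendsto_log_atTop).congr' ?_
  filter_upwards [eventually_gt_atTop 0] with x hx
  simp [logMean, moebiusMean, Real.exp_log hx]

/-! ### Uniqueness of Mellin-Stieltjes transforms. -/

/-- A measure carried by `[1, ∞)` is determined by its Mellin-Stieltjes transform. -/
theorem eq_of_mellinStieltjes_eq {A B : Measure ℝ} (hA : A (Set.Iio 1) = 0)
    (hB : B (Set.Iio 1) = 0) (hAi : Integrable (fun x : ℝ => (x : ℂ) ^ (-(2 : ℂ))) A)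
    (hBi : Integrable (fun x : ℝ => (x : ℂ) ^ (-(2 : ℂ))) B)
    (h : ∀ s : ℂ, 1 < s.re → mellinStieltjes A s = mellinStieltjes B s) : A = B := by
  -- The weight x^(-2) makes the measures finite. Pushed forward by log, they have the transform on
  -- the line Re s = 2 as characteristic function; exp and the inverse weight then recover the
  -- original measures.
  set w : ℝ → ENNReal := fun x => ENNReal.ofReal ((x ^ 2)⁻¹)
  have hw : Measurable w := by fun_prop
  have hnorm : ∀ x : ℝ, 1 ≤ x → ‖(x : ℂ) ^ (-(2 : ℂ))‖ₑ = w x := fun x hx => by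
    rw [← ofReal_norm, Complex.norm_cpow_eq_rpow_re_of_pos (by linarith)]
    simp only [w]
    congr 1
    rw [Complex.neg_re, Complex.re_ofNat, Real.rpow_neg (by linarith)]
    norm_cast
  have hfinite : ∀ {D : Measure ℝ}, D (Set.Iio 1) = 0 →
      Integrable (fun x : ℝ => (x : ℂ) ^ (-(2 : ℂ))) D → IsFiniteMeasure (D.withDensity w) := by
    intro D hD hDi
    refine isFiniteMeasure_withDensity ?_
    rw [← lintegral_congr_ae ((ae_one_le hD).mono hnorm)]
    exact hDi.2.ne
  have hchar : ∀ {D : Measure ℝ}, D (Set.Iio 1) = 0 → ∀ t : ℝ,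
      charFun ((D.withDensity w).map Real.log) t = mellinStieltjes D (2 - t * Complex.I) := by
    intro D hD t
    rw [charFun_apply_real, integral_map (by fun_prop) (by fun_prop),
      integral_withDensity_eq_integral_toReal_smul hw (ae_of_all _ fun x => ENNReal.ofReal_lt_top)]
    refine integral_congr_ae ?_
    filter_upwards [ae_one_le hD] with x hx
    have hx0 : 0 < x := by linarith
    have hxc : (x : ℂ) ≠ 0 := by exact_mod_cast hx0.ne'
    rw [neg_sub, sub_eq_add_neg, Complex.cpow_add _ _ hxc, Complex.cpow_def_of_ne_zero hxc,
      ← Complex.ofReal_log hx0.le, ENNReal.toReal_ofReal (by positivity), Complex.real_smul,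
      Complex.cpow_neg, mul_comm]
    push_cast
    congr 2
    · ring
    · norm_cast
  have hrec : ∀ {D : Measure ℝ}, D (Set.Iio 1) = 0 →
      (((D.withDensity w).map Real.log).map Real.exp).withDensity (fun x => (w x)⁻¹) = D := by
    intro D hD
    rw [Measure.map_map (by fun_prop) (by fun_prop)]
    have h1 : Real.exp ∘ Real.log =ᵐ[D.withDensity w] id := by
      refine (withDensity_absolutelyContinuous D w).ae_le ?_
      filter_upwards [ae_one_le hD] with x hx
      exact Real.exp_log (by linarith)
    rw [Measure.map_congr h1, Measure.map_id]
    refine withDensity_inv_same hw ?_ (ae_of_all _ fun x => ENNReal.ofReal_ne_top)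
    filter_upwards [ae_one_le hD] with x hx
    simp only [w, ne_eq, ENNReal.ofReal_eq_zero, not_le]
    positivity
  have := hfinite hA hAi
  have := hfinite hB hBi
  have heq : (A.withDensity w).map Real.log = (B.withDensity w).map Real.log := by
    refine Measure.ext_of_charFun (funext fun t => ?_)
    rw [hchar hA, hchar hB, h _ (by simp)]
  rw [← hrec hA, ← hrec hB, heq]

/-- Markov's inequality: |t^(-2)| is bounded below on [1, |x| + 1]. -/
theorem isLocallyFiniteMeasure_of_integrable_cpow {A : Measure ℝ} (hA : A (Set.Iio 1) = 0)
    (hAi : Integrable (fun x : ℝ => (x : ℂ) ^ (-(2 : ℂ))) A) : IsLocallyFiniteMeasure A := by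
  refine ⟨fun x => ⟨Set.Iic (|x| + 1), Iic_mem_nhds (by linarith [le_abs_self x]), ?_⟩⟩
  have hpos : (0 : ℝ) < ((|x| + 1) ^ 2)⁻¹ := by positivity
  have h := hAi.measure_norm_ge_lt_top hpos
  refine (measure_mono (fun t ht => ?_)).trans_lt
    ((measure_union_le (Set.Iio 1) {t : ℝ | ((|x| + 1) ^ 2)⁻¹ ≤ ‖(t : ℂ) ^ (-(2 : ℂ))‖}).trans_lt
      (by rwa [hA, zero_add]))
  rcases lt_or_ge t 1 with h1 | h1
  · exact Or.inl h1
  · refine Or.inr ?_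
    have ht0 : 0 < t := by linarith
    change ((|x| + 1) ^ 2)⁻¹ ≤ ‖(t : ℂ) ^ (-(2 : ℂ))‖
    rw [Complex.norm_cpow_eq_rpow_re_of_pos ht0, Complex.neg_re, Complex.re_ofNat,
      Real.rpow_neg ht0.le]
    refine inv_anti₀ (by positivity) ?_
    have ht : t ≤ |x| + 1 := ht
    norm_cast
    gcongr

/-! ### Multiplicative convolution and its exponential. -/

theorem ae_prod_one_le {A B : Measure ℝ} [SFinite A] [SFinite B] (hA : A (Set.Iio 1) = 0)
    (hB : B (Set.Iio 1) = 0) : ∀ᵐ z ∂A.prod B, 1 ≤ z.1 ∧ 1 ≤ z.2 := by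
  have h1 : ∀ᵐ z ∂A.prod B, 1 ≤ z.1 := Measure.quasiMeasurePreserving_fst.ae (ae_one_le hA)
  have h2 : ∀ᵐ z ∂A.prod B, 1 ≤ z.2 := Measure.quasiMeasurePreserving_snd.ae (ae_one_le hB)
  exact h1.and h2

theorem mconv_Iio_one {A B : Measure ℝ} [SFinite A] [SFinite B] (hA : A (Set.Iio 1) = 0)
    (hB : B (Set.Iio 1) = 0) : (A.mconv B) (Set.Iio 1) = 0 := by
  rw [Measure.mconv, Measure.map_apply (by fun_prop) measurableSet_Iio]
  refine measure_mono_null (fun z hz => ?_) (ae_iff.1 (ae_prod_one_le hA hB))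
  intro h
  have h1 : z.1 * z.2 < 1 := hz
  nlinarith [h.1, h.2]

/-- Both factors are at least 1, so a product at most x forces each factor to be at most x. -/
theorem mconv_Iic_lt_top {A B : Measure ℝ} [SFinite A] [SFinite B] (hA : A (Set.Iio 1) = 0)
    (hB : B (Set.Iio 1) = 0) {x : ℝ} (hAf : A (Set.Iic x) < ⊤) (hBf : B (Set.Iic x) < ⊤) :
    (A.mconv B) (Set.Iic x) < ⊤ := by
  rw [Measure.mconv, Measure.map_apply (by fun_prop) measurableSet_Iic]
  have hle : (A.prod B) ((fun z : ℝ × ℝ => z.1 * z.2) ⁻¹' Set.Iic x) ≤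
      (A.prod B) (Set.Iic x ×ˢ Set.Iic x) := by
    refine measure_mono_ae ?_
    filter_upwards [ae_prod_one_le hA hB] with z hz h
    have h : z.1 * z.2 ≤ x := h
    exact ⟨(by nlinarith [hz.1, hz.2] : z.1 ≤ x), (by nlinarith [hz.1, hz.2] : z.2 ≤ x)⟩
  refine hle.trans_lt ?_
  rw [Measure.prod_prod]
  exact ENNReal.mul_lt_top hAf hBf

theorem isLocallyFiniteMeasure_of_Iic_lt_top {A : Measure ℝ} (h : ∀ x, A (Set.Iic x) < ⊤) :
    IsLocallyFiniteMeasure A :=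
  ⟨fun x => ⟨Set.Iic (x + 1), Iic_mem_nhds (by linarith), h _⟩⟩

theorem integrable_mconv_of_multiplicative {A B : Measure ℝ} [SFinite A] [SFinite B]
    (hA : A (Set.Iio 1) = 0) (hB : B (Set.Iio 1) = 0) {𝕜 : Type*} [RCLike 𝕜] {g : ℝ → 𝕜}
    (hg : Measurable g) (hmul : ∀ x y, 1 ≤ x → 1 ≤ y → g (x * y) = g x * g y)
    (hAi : Integrable g A) (hBi : Integrable g B) :
    Integrable g (A.mconv B) ∧ ∫ x, g x ∂(A.mconv B) = (∫ x, g x ∂A) * ∫ x, g x ∂B := by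
  have hae : (fun z : ℝ × ℝ => g z.1 * g z.2) =ᵐ[A.prod B] fun z => g (z.1 * z.2) := by
    filter_upwards [ae_prod_one_le hA hB] with z hz
    exact (hmul _ _ hz.1 hz.2).symm
  refine ⟨?_, ?_⟩
  · rw [Measure.mconv, integrable_map_measure hg.aestronglyMeasurable (by fun_prop)]
    exact (hAi.mul_prod hBi).congr hae
  · rw [Measure.mconv, integral_map (by fun_prop) hg.aestronglyMeasurable, ← integral_prod_mul,
      integral_congr_ae hae]

theorem cpow_mul_of_one_le {x y : ℝ} (hx : 1 ≤ x) (hy : 1 ≤ y) (s : ℂ) :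
    ((x * y : ℝ) : ℂ) ^ s = (x : ℂ) ^ s * (y : ℂ) ^ s := by
  rw [Complex.ofReal_mul, Complex.mul_cpow_ofReal_nonneg (by linarith) (by linarith)]

theorem mellinStieltjes_mconv {A B : Measure ℝ} [SFinite A] [SFinite B]
    (hA : A (Set.Iio 1) = 0) (hB : B (Set.Iio 1) = 0) {s : ℂ}
    (hAi : Integrable (fun x : ℝ => (x : ℂ) ^ (-s)) A)
    (hBi : Integrable (fun x : ℝ => (x : ℂ) ^ (-s)) B) :
    Integrable (fun x : ℝ => (x : ℂ) ^ (-s)) (A.mconv B) ∧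
      mellinStieltjes (A.mconv B) s = mellinStieltjes A s * mellinStieltjes B s :=
  integrable_mconv_of_multiplicative hA hB (by fun_prop)
    (fun _ _ hx hy => cpow_mul_of_one_le hx hy _) hAi hBi

/-- The powers of a measure under multiplicative convolution. -/
noncomputable def mconvPow (A : Measure ℝ) : ℕ → Measure ℝ
  | 0 => Measure.dirac 1
  | n + 1 => A.mconv (mconvPow A n)

instance sFinite_mconvPow (A : Measure ℝ) [SFinite A] : ∀ n, SFinite (mconvPow A n)
  | 0 => by unfold mconvPow; infer_instance
  | n + 1 => by
    have := sFinite_mconvPow A n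
    unfold mconvPow
    infer_instance

theorem mconvPow_Iio_one {A : Measure ℝ} [SFinite A] (hA : A (Set.Iio 1) = 0) (n : ℕ) :
    mconvPow A n (Set.Iio 1) = 0 := by
  induction n with
  | zero => simp [mconvPow]
  | succ n ih => exact mconv_Iio_one hA ih

theorem integral_mconvPow {A : Measure ℝ} [SFinite A] (hA : A (Set.Iio 1) = 0) {𝕜 : Type*}
    [RCLike 𝕜] {g : ℝ → 𝕜} (hg : Measurable g) (h1 : g 1 = 1)
    (hmul : ∀ x y, 1 ≤ x → 1 ≤ y → g (x * y) = g x * g y) (hAi : Integrable g A) (n : ℕ) :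
    Integrable g (mconvPow A n) ∧ ∫ x, g x ∂(mconvPow A n) = (∫ x, g x ∂A) ^ n := by
  induction n with
  | zero => simp [mconvPow, h1, integrable_dirac]
  | succ n ih =>
    have h := integrable_mconv_of_multiplicative hA (mconvPow_Iio_one hA n) hg hmul hAi ih.1
    exact ⟨h.1, h.2.trans (by rw [ih.2, pow_succ'])⟩

/-- The measure `∑ₙ A ^ (k n) / (k n)!`, a part of the convolution exponential of `A`. -/
noncomputable def mconvExp (A : Measure ℝ) (k : ℕ → ℕ) : Measure ℝ :=
  Measure.sum fun n => ENNReal.ofReal ((k n).factorial : ℝ)⁻¹ • mconvPow A (k n)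

theorem mconvExp_Iio_one {A : Measure ℝ} [SFinite A] (hA : A (Set.Iio 1) = 0) (k : ℕ → ℕ) :
    mconvExp A k (Set.Iio 1) = 0 := by
  simp [mconvExp, mconvPow_Iio_one hA]

/-- The transform turns convolution powers into powers. Absolute convergence follows from the
exponential series of ∫ |x^(-s)| dA, since |x^(-s)| is multiplicative too. -/
theorem mellinStieltjes_mconvExp {A : Measure ℝ} [SFinite A] (hA : A (Set.Iio 1) = 0) {k : ℕ → ℕ}
    (hk : Function.Injective k) {s : ℂ} (hAi : Integrable (fun x : ℝ => (x : ℂ) ^ (-s)) A) :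
    Integrable (fun x : ℝ => (x : ℂ) ^ (-s)) (mconvExp A k) ∧
      HasSum (fun n => mellinStieltjes A s ^ k n / ((k n).factorial : ℂ))
        (mellinStieltjes (mconvExp A k) s) := by
  have hpow := integral_mconvPow hA (g := fun x : ℝ => (x : ℂ) ^ (-s)) (by fun_prop) (by simp)
    (fun _ _ hx hy => cpow_mul_of_one_le hx hy _) hAi
  have hnorm := integral_mconvPow hA (g := fun x : ℝ => ‖(x : ℂ) ^ (-s)‖) (by fun_prop) (by simp)
    (fun _ _ hx hy => by rw [cpow_mul_of_one_le hx hy, norm_mul]) hAi.norm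
  have hI : Integrable (fun x : ℝ => (x : ℂ) ^ (-s)) (mconvExp A k) := by
    refine integrable_sum_measure (fun n => (hpow _).1.smul_measure ENNReal.ofReal_ne_top) ?_
    simp_rw [integral_smul_measure, (hnorm _).2]
    refine ((Real.summable_pow_div_factorial (∫ x : ℝ, ‖(x : ℂ) ^ (-s)‖ ∂A)).comp_injective
      hk).congr fun n => ?_
    rw [ENNReal.toReal_ofReal (by positivity), smul_eq_mul, Function.comp, div_eq_inv_mul]
  refine ⟨hI, ?_⟩
  have h := hasSum_integral_measure hI
  refine h.congr_fun fun n => ?_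
  rw [integral_smul_measure, (hpow _).2, ENNReal.toReal_ofReal (by positivity), Complex.real_smul]
  push_cast
  rw [div_eq_inv_mul]
  rfl

/-! ### Existence and uniqueness of the convolution inverse. -/

/-- Computing P * N * P' by either inverse relation leaves the common term Q * Q' * N, which may be
cancelled because it is σ-finite. -/
theorem IsConvInverse.add_eq_add {N P Q P' Q' : Measure ℝ} [IsLocallyFiniteMeasure N]
    (hN : N (Set.Iio 1) = 0) (h : IsConvInverse N P Q) (h' : IsConvInverse N P' Q') :
    P + Q' = Q + P' := by
  have := h.locallyFinite_P
  have := h.locallyFinite_Q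
  have := h'.locallyFinite_P
  have := h'.locallyFinite_Q
  have hR : SigmaFinite (Q.mconv (Q'.mconv N)) := by
    have := isLocallyFiniteMeasure_of_Iic_lt_top fun x =>
      mconv_Iic_lt_top h.support_Q (mconv_Iio_one h'.support_Q hN)
        (measure_Iic_lt_top h.support_Q x)
        (mconv_Iic_lt_top h'.support_Q hN (measure_Iic_lt_top h'.support_Q x)
          (measure_Iic_lt_top hN x))
    infer_instance
  have e1 : (P.mconv N).mconv P' = Q.mconv (Q'.mconv N) + (Q + P') := by
    rw [h.conv_eq, Measure.add_mconv, Measure.dirac_one_mconv, Measure.mconv_assoc,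
      Measure.mconv_comm N P', h'.conv_eq, Measure.mconv_add, Measure.mconv_dirac_one, add_assoc]
  have e2 : (P.mconv N).mconv P' = Q.mconv (Q'.mconv N) + (P + Q') := by
    rw [Measure.mconv_assoc, Measure.mconv_comm N P', h'.conv_eq, Measure.mconv_add,
      Measure.mconv_dirac_one, Measure.mconv_comm Q' N, ← Measure.mconv_assoc, h.conv_eq,
      Measure.add_mconv, Measure.dirac_one_mconv, Measure.mconv_assoc, add_assoc, add_comm Q' P]
  exact (Measure.add_right_inj _ _ _).1 (e2.symm.trans e1)

theorem moebiusMean_eq {P Q P' Q' : Measure ℝ} [IsLocallyFiniteMeasure P]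
    [IsLocallyFiniteMeasure Q] [IsLocallyFiniteMeasure P'] [IsLocallyFiniteMeasure Q']
    (hP : P (Set.Iio 1) = 0) (hQ : Q (Set.Iio 1) = 0) (hP' : P' (Set.Iio 1) = 0)
    (hQ' : Q' (Set.Iio 1) = 0) (h : P + Q' = Q + P') : moebiusMean P Q = moebiusMean P' Q' := by
  funext x
  have hI : ∀ {A : Measure ℝ} [IsLocallyFiniteMeasure A], A (Set.Iio 1) = 0 →
      IntegrableOn (fun t : ℝ => t⁻¹) (Set.Iic x) A := fun hA =>
    integrableOn_inv_Iic hA (measure_Iic_lt_top hA) x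
  have e := congrArg (fun A : Measure ℝ => ∫ t in Set.Iic x, t⁻¹ ∂A) h
  simp only [Measure.restrict_add] at e
  rw [integral_add_measure (hI hP) (hI hQ'), integral_add_measure (hI hQ) (hI hP')] at e
  unfold moebiusMean
  linarith

theorem mellinStieltjes_add {A B : Measure ℝ} {s : ℂ}
    (hA : Integrable (fun x : ℝ => (x : ℂ) ^ (-s)) A)
    (hB : Integrable (fun x : ℝ => (x : ℂ) ^ (-s)) B) :
    mellinStieltjes (A + B) s = mellinStieltjes A s + mellinStieltjes B s :=
  integral_add_measure hA hB

theorem mellinStieltjes_dirac_one (s : ℂ) : mellinStieltjes (Measure.dirac 1) s = 1 := by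
  simp [mellinStieltjes]

/-- The even and odd parts of the convolution exponential of `dPi` add up to `dN`, and their
difference is its convolution inverse. -/
theorem IsNumberSystem.mconvExp_spec {dN dPi : Measure ℝ} (h : IsNumberSystem dN dPi) :
    mconvExp dPi (fun n => 2 * n) + mconvExp dPi (fun n => 2 * n + 1) = dN ∧
    IsConvInverse dN (mconvExp dPi fun n => 2 * n) (mconvExp dPi fun n => 2 * n + 1) ∧
    ∀ s : ℂ, 1 < s.re → mellinStieltjes (mconvExp dPi fun n => 2 * n) s -
      mellinStieltjes (mconvExp dPi fun n => 2 * n + 1) s =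
        Complex.exp (-mellinStieltjes dPi s) := by
  have := h.locallyFinite_N
  have := h.locallyFinite_Pi
  have hPi0 : dPi (Set.Iio 1) = 0 :=
    measure_mono_null (fun t ht => le_of_lt (Set.mem_Iio.1 ht)) h.support_Pi
  have hinj0 : Function.Injective fun n : ℕ => 2 * n := fun a b hab => by
    simpa using hab
  have hinj1 : Function.Injective fun n : ℕ => 2 * n + 1 := fun a b hab => by
    simpa using hab
  set P := mconvExp dPi fun n => 2 * n
  set Q := mconvExp dPi fun n => 2 * n + 1
  have hP0 : P (Set.Iio 1) = 0 := mconvExp_Iio_one hPi0 _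
  have hQ0 : Q (Set.Iio 1) = 0 := mconvExp_Iio_one hPi0 _
  have hPI : ∀ s : ℂ, 1 < s.re → Integrable (fun x : ℝ => (x : ℂ) ^ (-s)) P := fun s hs =>
    (mellinStieltjes_mconvExp hPi0 hinj0 (h.integrable_Pi s hs)).1
  have hQI : ∀ s : ℂ, 1 < s.re → Integrable (fun x : ℝ => (x : ℂ) ^ (-s)) Q := fun s hs =>
    (mellinStieltjes_mconvExp hPi0 hinj1 (h.integrable_Pi s hs)).1
  have hPm : ∀ s : ℂ, 1 < s.re → mellinStieltjes P s = Complex.cosh (mellinStieltjes dPi s) :=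
    fun s hs => (mellinStieltjes_mconvExp hPi0 hinj0 (h.integrable_Pi s hs)).2.unique
      (Complex.hasSum_cosh _)
  have hQm : ∀ s : ℂ, 1 < s.re → mellinStieltjes Q s = Complex.sinh (mellinStieltjes dPi s) :=
    fun s hs => (mellinStieltjes_mconvExp hPi0 hinj1 (h.integrable_Pi s hs)).2.unique
      (Complex.hasSum_sinh _)
  have h2 : 1 < (2 : ℂ).re := by norm_num
  have := isLocallyFiniteMeasure_of_integrable_cpow hP0 (hPI 2 h2)
  have := isLocallyFiniteMeasure_of_integrable_cpow hQ0 (hQI 2 h2)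
  refine ⟨?_, ⟨inferInstance, inferInstance, hP0, hQ0, ?_⟩, fun s hs => ?_⟩
  -- cosh + sinh = exp, so P + Q has the transform ζ.
  · refine eq_of_mellinStieltjes_eq (by simp [hP0, hQ0]) h.support_N
      ((hPI 2 h2).add_measure (hQI 2 h2)) (h.integrable_N 2 h2) fun s hs => ?_
    rw [mellinStieltjes_add (hPI s hs) (hQI s hs), hPm s hs, hQm s hs, h.zeta_eq s hs,
      Complex.cosh_add_sinh]
  -- (cosh - sinh)·exp = 1, with the sinh term moved to the other side.
  · have hPN := fun s hs => mellinStieltjes_mconv hP0 h.support_N (hPI s hs) (h.integrable_N s hs)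
    have hQN := fun s hs => mellinStieltjes_mconv hQ0 h.support_N (hQI s hs) (h.integrable_N s hs)
    have hδ : ∀ s : ℂ, Integrable (fun x : ℝ => (x : ℂ) ^ (-s)) (Measure.dirac 1) := fun s =>
      integrable_dirac (by simp)
    refine eq_of_mellinStieltjes_eq (mconv_Iio_one hP0 h.support_N)
      (by simp [mconv_Iio_one hQ0 h.support_N]) (hPN 2 h2).1 ((hQN 2 h2).1.add_measure (hδ 2))
      fun s hs => ?_
    rw [mellinStieltjes_add (hQN s hs).1 (hδ s), (hPN s hs).2, (hQN s hs).2,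
      mellinStieltjes_dirac_one, hPm s hs, hQm s hs, h.zeta_eq s hs, ← sub_eq_iff_eq_add',
      ← sub_mul, Complex.cosh_sub_sinh, ← Complex.exp_add, neg_add_cancel, Complex.exp_zero]
  · rw [hPm s hs, hQm s hs, Complex.cosh_sub_sinh]

theorem IsNumberSystem.moebiusMean_isLittleO {dN dPi : Measure ℝ} (h : IsNumberSystem dN dPi)
    {a : ℝ} (ha : countingFun dN ~[atTop] fun x => a * x)
    (hext : HasContinuousExtension (mellinStieltjes dPi)) {dP dQ : Measure ℝ}
    (hPQ : IsConvInverse dN dP dQ) : moebiusMean dP dQ =o[atTop] (fun _ : ℝ => (1 : ℝ)) := by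
  have := h.locallyFinite_N
  obtain ⟨hsum, hinv, hmellin⟩ := h.mconvExp_spec
  have := hPQ.locallyFinite_P
  have := hPQ.locallyFinite_Q
  have := hinv.locallyFinite_P
  have := hinv.locallyFinite_Q
  rw [moebiusMean_eq hPQ.support_P hPQ.support_Q hinv.support_P hinv.support_Q
    (hPQ.add_eq_add h.support_N hinv)]
  exact Beurling.moebiusMean_isLittleO h.support_N hsum.le ha hext hmellin

/-! ### Discrete systems. -/

theorem IsPrimeSystem.one_lt_apply {p : ℕ → ℝ} (hp : IsPrimeSystem p) (k : ℕ) : 1 < p k :=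
  hp.one_lt.trans_le (hp.mono (Nat.zero_le k))

theorem IsPrimeSystem.one_le_genInt {p : ℕ → ℝ} (hp : IsPrimeSystem p) (α : ℕ →₀ ℕ) :
    1 ≤ genInt p α :=
  Finset.prod_induction _ (fun y => (1 : ℝ) ≤ y) (fun _ _ => one_le_mul_of_one_le_of_one_le) le_rfl
    fun k _ => one_le_pow₀ (hp.one_lt_apply k).le

/-- The measure with mass `c α` at the generalized integer with exponent vector `α`. -/
noncomputable def genIntMeasure (p : ℕ → ℝ) (c : (ℕ →₀ ℕ) → ℝ) : Measure ℝ :=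
  Measure.sum fun α => ENNReal.ofReal (c α) • Measure.dirac (genInt p α)

theorem genIntMeasure_Iio_one {p : ℕ → ℝ} (hp : IsPrimeSystem p) (c : (ℕ →₀ ℕ) → ℝ) :
    genIntMeasure p c (Set.Iio 1) = 0 := by
  simp [genIntMeasure, hp.one_le_genInt]

theorem genIntMeasure_Iic {p : ℕ → ℝ} (hp : IsPrimeSystem p) (c : (ℕ →₀ ℕ) → ℝ) (x : ℝ) :
    genIntMeasure p c (Set.Iic x) =
      ∑ α ∈ (finite_genInt_le hp x).toFinset, ENNReal.ofReal (c α) := by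
  rw [genIntMeasure, Measure.sum_apply _ measurableSet_Iic, tsum_eq_sum]
  · refine Finset.sum_congr rfl fun α hα => ?_
    have : genInt p α ≤ x := by simpa using hα
    simp [this]
  · intro α hα
    have : ¬ genInt p α ≤ x := by simpa using hα
    simp [this]

theorem isLocallyFiniteMeasure_genIntMeasure {p : ℕ → ℝ} (hp : IsPrimeSystem p)
    (c : (ℕ →₀ ℕ) → ℝ) : IsLocallyFiniteMeasure (genIntMeasure p c) := by
  refine isLocallyFiniteMeasure_of_Iic_lt_top fun x => ?_
  rw [genIntMeasure_Iic hp]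
  exact ENNReal.sum_lt_top.2 fun _ _ => ENNReal.ofReal_lt_top

theorem countingFun_genIntMeasure {p : ℕ → ℝ} (hp : IsPrimeSystem p) :
    countingFun (genIntMeasure p fun _ => 1) = intCount p := by
  funext x
  rw [countingFun, measureReal_def, genIntMeasure_Iic hp, intCount,
    Set.ncard_eq_toFinset_card _ (finite_genInt_le hp x)]
  simp

theorem setIntegral_inv_genIntMeasure {p : ℕ → ℝ} (hp : IsPrimeSystem p) (c : (ℕ →₀ ℕ) → ℝ)
    (x : ℝ) : ∫ t in Set.Iic x, t⁻¹ ∂(genIntMeasure p c) =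
      ∑ α ∈ (finite_genInt_le hp x).toFinset, max (c α) 0 * (genInt p α)⁻¹ := by
  have := isLocallyFiniteMeasure_genIntMeasure hp c
  have h0 := genIntMeasure_Iio_one hp c
  have hI := (integrableOn_inv_Iic h0 (measure_Iic_lt_top h0) x).integrable_indicator
    measurableSet_Iic
  rw [← integral_indicator measurableSet_Iic, genIntMeasure, integral_sum_measure hI, tsum_eq_sum]
  · refine Finset.sum_congr rfl fun α hα => ?_
    have : genInt p α ≤ x := by simpa using hα
    simp [this, ENNReal.toReal_ofReal']
  · intro α hα
    have : ¬ genInt p α ≤ x := by simpa using hα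
    simp [this]

/-- `ENNReal.ofReal` truncates negative masses to 0, so the two measures carry the positive and
negative parts of μ. -/
theorem moebiusMean_genIntMeasure {p : ℕ → ℝ} (hp : IsPrimeSystem p) :
    moebiusMean (genIntMeasure p moebius) (genIntMeasure p fun α => -moebius α) =
      moebiusSum p := by
  funext x
  rw [moebiusMean, setIntegral_inv_genIntMeasure hp, setIntegral_inv_genIntMeasure hp,
    ← Finset.sum_sub_distrib, moebiusSum, finsum_mem_eq_finite_toFinset_sum _ (finite_genInt_le hp x)]
  refine Finset.sum_congr rfl fun α _ => ?_
  rw [← sub_mul, max_zero_sub_eq_self, div_eq_mul_inv]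

theorem moebius_mem (α : ℕ →₀ ℕ) : moebius α = 1 ∨ moebius α = -1 ∨ moebius α = 0 := by
  unfold moebius
  split_ifs
  · rcases neg_one_pow_eq_or ℝ α.support.card with h | h <;> simp [h]
  · simp

theorem genIntMeasure_add_le (p : ℕ → ℝ) :
    genIntMeasure p moebius + genIntMeasure p (fun α => -moebius α) ≤
      genIntMeasure p fun _ => 1 := by
  unfold genIntMeasure
  rw [Measure.sum_add_sum]
  refine Measure.le_iff.2 fun S hS => ?_
  rw [Measure.sum_apply _ hS, Measure.sum_apply _ hS]
  refine ENNReal.tsum_le_tsum fun α => ?_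
  rw [Measure.add_apply, Measure.smul_apply, Measure.smul_apply, Measure.smul_apply, ← add_smul]
  have h1 : ENNReal.ofReal (-1) = 0 := ENNReal.ofReal_of_nonpos (by norm_num)
  rcases moebius_mem α with h | h | h <;> simp [h, h1]

theorem hasSum_mellinStieltjes_genIntMeasure {p : ℕ → ℝ} {c : (ℕ →₀ ℕ) → ℝ} {s : ℂ}
    (hI : Integrable (fun x : ℝ => (x : ℂ) ^ (-s)) (genIntMeasure p c)) :
    HasSum (fun α => (max (c α) 0 : ℝ) * (genInt p α : ℂ) ^ (-s))
      (mellinStieltjes (genIntMeasure p c) s) := by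
  have h := hasSum_integral_measure hI
  simp only [integral_smul_measure, ENNReal.toReal_ofReal', integral_dirac,
    Complex.real_smul] at h
  exact h

/-- N(x) = O(x) alone forces convergence for Re s > 1, through the linear growth of the logarithmic
mean. -/
theorem integrable_cpow_genIntMeasure {p : ℕ → ℝ} (hp : IsPrimeSystem p) {a : ℝ}
    (ha : intCount p ~[atTop] fun x => a * x) {s : ℂ} (hs : 1 < s.re) :
    Integrable (fun x : ℝ => (x : ℂ) ^ (-s)) (genIntMeasure p fun _ => 1) := by
  have := isLocallyFiniteMeasure_genIntMeasure hp fun _ => 1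
  have h0 := genIntMeasure_Iio_one hp fun _ => 1
  have hfin := measure_Iic_lt_top h0
  obtain ⟨C, hC0, hC⟩ := exists_countingFun_le h0 hfin (by rwa [countingFun_genIntMeasure hp])
  have h := (integrable_cpow_and_laplace_logMean h0 hfin
    (logMean_le_of_linear_growth h0 hfin hC0 hC) (s := s - 1) (by simpa using hs)).1
  simpa using h

/-- The squarefree exponent vector with support `S`. -/
noncomputable def squarefreeVector (S : Finset ℕ) : ℕ →₀ ℕ := Finsupp.indicator S fun _ _ => 1

theorem support_squarefreeVector (S : Finset ℕ) : (squarefreeVector S).support = S := by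
  ext k
  by_cases h : k ∈ S <;> simp [squarefreeVector, h]

theorem squarefreeVector_injective : Function.Injective squarefreeVector := fun S T h => by
  rw [← support_squarefreeVector S, h, support_squarefreeVector]

theorem genInt_squarefreeVector (p : ℕ → ℝ) (S : Finset ℕ) :
    genInt p (squarefreeVector S) = ∏ k ∈ S, p k := by
  rw [genInt, Finsupp.prod, support_squarefreeVector]
  refine Finset.prod_congr rfl fun k hk => ?_
  simp [squarefreeVector, hk]

theorem moebius_squarefreeVector (S : Finset ℕ) : moebius (squarefreeVector S) = (-1) ^ S.card := by
  rw [moebius, if_pos, support_squarefreeVector]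
  intro k
  by_cases h : k ∈ S <;> simp [squarefreeVector, h]

theorem moebius_eq_zero_of_notMem_range {α : ℕ →₀ ℕ} (h : α ∉ Set.range squarefreeVector) :
    moebius α = 0 := by
  rw [moebius, if_neg]
  intro hα
  refine h ⟨α.support, Finsupp.ext fun k => ?_⟩
  have := hα k
  by_cases hk : α k = 0
  · simp [squarefreeVector, hk]
  · simp [squarefreeVector, hk]
    omega

theorem ofReal_prod_cpow {p : ℕ → ℝ} (hp : ∀ k, 0 ≤ p k) (s : ℂ) (S : Finset ℕ) :
    ((∏ k ∈ S, p k : ℝ) : ℂ) ^ s = ∏ k ∈ S, (p k : ℂ) ^ s := by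
  induction S using Finset.cons_induction with
  | empty => simp
  | cons k S hk ih =>
    rw [Finset.prod_cons, Finset.prod_cons, ← ih, Complex.ofReal_mul,
      Complex.mul_cpow_ofReal_nonneg (hp k) (Finset.prod_nonneg fun i _ => hp i)]

/-- The sum over j is -log(1 - p_k^(-s)), so the exponential is the Euler product ∏ (1 - p_k^(-s)),
which expands over finite sets of indices. -/
theorem exp_neg_logZeta {p : ℕ → ℝ} (hp : IsPrimeSystem p) {s : ℂ} (hs : 0 < s.re)
    (hsum : Summable fun k => ‖(p k : ℂ) ^ (-s)‖) :
    Complex.exp (-logZeta p s) = ∑' S : Finset ℕ, ∏ k ∈ S, -(p k : ℂ) ^ (-s) := by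
  set z : ℕ → ℂ := fun k => (p k : ℂ) ^ (-s) with hz
  have hp0 : ∀ k, 0 < p k := fun k => one_pos.trans (hp.one_lt_apply k)
  have hnorm : ∀ k, ‖z k‖ = p k ^ (-s.re) := fun k => by
    rw [hz, Complex.norm_cpow_eq_rpow_re_of_pos (hp0 k), Complex.neg_re]
  have hr : ‖z 0‖ < 1 := by
    rw [hnorm]; exact Real.rpow_lt_one_of_one_lt_of_neg hp.one_lt (by linarith)
  have hle : ∀ k, ‖z k‖ ≤ ‖z 0‖ := fun k => by
    rw [hnorm, hnorm]
    exact Real.rpow_le_rpow_of_nonpos (hp0 0) (hp.mono (Nat.zero_le k)) (by linarith)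
  have hlt : ∀ k, ‖z k‖ < 1 := fun k => (hle k).trans_lt hr
  have hterm : ∀ k j : ℕ, (p k : ℂ) ^ (-(((j : ℂ) + 1) * s)) / ((j : ℂ) + 1) =
      z k ^ (j + 1) / ((j : ℂ) + 1) := fun k j => by
    rw [hz, ← Complex.cpow_nat_mul]
    push_cast
    rw [mul_neg]
  -- Since |z_k| ≤ |z_0| < 1, the terms are dominated by |z_k|·|z_0|^j.
  have hsummable : Summable fun q : ℕ × ℕ => z q.1 ^ (q.2 + 1) / ((q.2 : ℂ) + 1) := by
    refine Summable.of_norm_bounded (Summable.mul_of_nonneg hsum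
      (summable_geometric_of_lt_one (norm_nonneg (z 0)) hr) (fun _ => norm_nonneg _)
      (fun _ => by positivity)) fun q => ?_
    rw [norm_div, norm_pow, pow_succ']
    have h1 : (1 : ℝ) ≤ ‖((q.2 : ℂ) + 1)‖ := by
      norm_cast
      simp
    refine (div_le_self (by positivity) h1).trans ?_
    exact mul_le_mul_of_nonneg_left (pow_le_pow_left₀ (norm_nonneg _) (hle _) _) (norm_nonneg _)
  have hlog : logZeta p s = -∑' k, Complex.log (1 + -z k) := by
    unfold logZeta
    simp_rw [hterm]
    rw [hsummable.tsum_prod, ← tsum_neg]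
    refine tsum_congr fun k => ?_
    have h := Complex.hasSum_taylorSeries_neg_log (hlt k)
    -- The Taylor series starts at n = 0 with the term z^0 / 0 = 0, which is split off to match the
    -- exponents j + 1.
    rw [← sub_eq_add_neg, ← h.tsum_eq, h.summable.tsum_eq_zero_add]
    simp
  have hsum' : Summable fun k => ‖-z k‖ := by simpa using hsum
  have hne : ∀ k, 1 + -z k ≠ 0 := fun k h => by
    have : z k = 1 := by linear_combination -h
    have := hlt k
    simp_all
  rw [hlog, neg_neg, Complex.cexp_tsum_eq_tprod hne
    (Complex.summable_log_one_add_of_summable hsum'.of_norm),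
    tprod_one_add (summable_finsetProd_of_summable_norm hsum')]

theorem mellinStieltjes_moebius {p : ℕ → ℝ} (hp : IsPrimeSystem p) {a : ℝ}
    (ha : intCount p ~[atTop] fun x => a * x) {s : ℂ} (hs : 1 < s.re) :
    mellinStieltjes (genIntMeasure p moebius) s -
      mellinStieltjes (genIntMeasure p fun α => -moebius α) s = Complex.exp (-logZeta p s) := by
  have hI := integrable_cpow_genIntMeasure hp ha hs
  have hle := genIntMeasure_add_le p
  have hP := hasSum_mellinStieltjes_genIntMeasure
    (hI.mono_measure ((Measure.le_add_right le_rfl).trans hle))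
  have hQ := hasSum_mellinStieltjes_genIntMeasure
    (hI.mono_measure ((Measure.le_add_left le_rfl).trans hle))
  have hsub := hP.sub hQ
  simp_rw [← sub_mul, ← Complex.ofReal_sub, max_zero_sub_eq_self] at hsub
  -- The primes are the generalized integers with exponent vectors `Finsupp.single k 1`, so this is
  -- a subseries of ζ.
  have hsum : Summable fun k => ‖(p k : ℂ) ^ (-s)‖ := by
    have h := hI.summable_of_dirac
    simp only [ENNReal.ofReal_one, ENNReal.toReal_one, one_mul] at h
    refine (h.comp_injective (Finsupp.single_left_injective one_ne_zero)).congr fun k => ?_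
    simp [genInt]
  rw [exp_neg_logZeta hp (by linarith) hsum, ← hsub.tsum_eq,
    ← squarefreeVector_injective.tsum_eq]
  · refine tsum_congr fun S => ?_
    rw [moebius_squarefreeVector, genInt_squarefreeVector,
      ofReal_prod_cpow fun k => (one_pos.trans (hp.one_lt_apply k)).le, Finset.prod_neg]
    push_cast
    rfl
  · intro α hα
    by_contra h
    exact hα (by simp [moebius_eq_zero_of_notMem_range h])

theorem IsPrimeSystem.moebiusSum_isLittleO {p : ℕ → ℝ} (hp : IsPrimeSystem p) {a : ℝ}
    (ha : intCount p ~[atTop] fun x => a * x) (hext : HasContinuousExtension (logZeta p)) :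
    moebiusSum p =o[atTop] (fun _ : ℝ => (1 : ℝ)) := by
  have := isLocallyFiniteMeasure_genIntMeasure hp
  rw [← moebiusMean_genIntMeasure hp]
  exact moebiusMean_isLittleO (genIntMeasure_Iio_one hp _) (genIntMeasure_add_le p)
    (by rwa [countingFun_genIntMeasure hp]) hext fun s hs => mellinStieltjes_moebius hp ha hs

end Beurling

theorem mainTheorem5 :
    -- general systems: `log ζ(s)` is `∫ x ^ (-s) dΠ(x)`, and `dM = dP - dQ` inverts `dN`
    (∀ (dN dPi : Measure ℝ) (a : ℝ), Beurling.IsNumberSystem dN dPi →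
      Beurling.countingFun dN ~[atTop] (fun x : ℝ => a * x) →
      Beurling.HasContinuousExtension (Beurling.mellinStieltjes dPi) →
      (∃ dP dQ : Measure ℝ, Beurling.IsConvInverse dN dP dQ) ∧
      ∀ dP dQ : Measure ℝ, Beurling.IsConvInverse dN dP dQ →
        Beurling.moebiusMean dP dQ =o[atTop] (fun _ : ℝ => (1 : ℝ))) ∧
    -- discrete systems
    (∀ (p : ℕ → ℝ) (a : ℝ), Beurling.IsPrimeSystem p →
      Beurling.intCount p ~[atTop] (fun x : ℝ => a * x) →
      Beurling.HasContinuousExtension (Beurling.logZeta p) →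
      Beurling.moebiusSum p =o[atTop] (fun _ : ℝ => (1 : ℝ))) := by
  refine ⟨fun dN dPi a h ha hext => ⟨⟨_, _, h.mconvExp_spec.2.1⟩, fun dP dQ hPQ =>
    h.moebiusMean_isLittleO ha hext hPQ⟩, fun p a hp ha hext => hp.moebiusSum_isLittleO ha hext⟩
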